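/- For $s\in\mathbb{C}$, $s\neq 0$, and $N\ge 2$ let $$\mathcal{L}_s(N)=\sum_{j=1}^{N}\sum_{\substack{k=1\\ k\ne j}}^{N}|z_{j,N}-z_{k,N}|^{-s},\qquad z_{k,N}=e^{2\pi i(k-1)/N},$$ be the Riesz $s$-energy of the $N$-th roots of unity, and let $\alpha_n(s)$, $n\ge 0$, be the coefficients in $$\left(\frac{\sin \pi z}{\pi z}\right)^{-s}=\sum_{n=0}^\infty \alpha_n(s)z^{2n},\qquad |z|<1,$$ where the left-hand side is $\exp(-s\log\frac{\sin\pi z}{\pi z})$ with the branch of the logarithm that vanishes at $z=0$. Let $\zeta$ be the Riemann zeta function, $\psi=\Gamma'/\Gamma$ the digamma function, $\gamma$ the Euler–Mascheroni constant and $(a)_M=a(a+1)\cdots(a+M-1)$, $(a)_0=1$. Let $s=2M+1$ with $M\in\{0,1,2,\dots\}$, and let $p$ be any integer with $p>M$. Then, as $N\to\infty$, $$\mathcal{L}_s(N)=c_M N^2\log N+\left(G_M+c_M\gamma\right)N^2+\frac{2}{(2\pi)^s}\sum_{\substack{n=0\\ n\ne M}}^{p}\alpha_n(s)\,\zeta(s-2n)\,N^{1+s-2n}+\mathcal{O}_{s,p}\!\left(N^{-1+s-2p}\right),$$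 where $$c_M=\frac1\pi\,\frac{(1/2)_M}{2^{2M}M!},\qquad G_M=c_M\left[\frac{\alpha_M'(2M+1)}{\alpha_M(2M+1)}+\frac12\psi(M+1)-\frac12\psi\!\left(M+\tfrac12\right)-\log\pi\right].$$ Here $\alpha_M(2M+1)\ne 0$, and the derivative of $\alpha_M$ with respect to $s$ at $s=2M+1$ is $$\alpha_M'(2M+1)=\sum_{m=0}^{M-1}\alpha_m(2M+1)\,\frac{\zeta(2(M-m))}{M-m}.$$ -/

import Mathlib

open scoped Nat
open Filter Asymptotics

noncomputable section

/-- The Riesz `s`-energy (`s ≠ 0`) of `N` points of the complex plane: the sum of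
`|z_j - z_k| ^ (-s)` over all ordered pairs `j ≠ k`. -/
def rieszEnergy (s : ℂ) {N : ℕ} (z : Fin N → ℂ) : ℂ :=
  ∑ j : Fin N, ∑ k ∈ Finset.univ.erase j, ((‖z j - z k‖ : ℝ) : ℂ) ^ (-s)

/-- The `N`-th roots of unity `exp (2 π i k / N)`, `k = 0, …, N - 1`. -/
def rootOfUnityPoint (N : ℕ) (k : Fin N) : ℂ :=
  Complex.exp (2 * Real.pi * Complex.I * ((k : ℕ) : ℂ) / N)

/-- The Riesz `s`-energy of the `N`-th roots of unity. -/
def rootsEnergy (s : ℂ) (N : ℕ) : ℂ :=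
  rieszEnergy s (rootOfUnityPoint N)

/-- The normalized sinc function on the complex plane. -/
def normSinc (z : ℂ) : ℂ :=
  if z = 0 then 1 else Complex.sin (Real.pi * z) / (Real.pi * z)

/-- The function `sinc ^ (-s) = exp (-s log sinc)`. As `normSinc` is close to `1` near `0`, the
principal logarithm is there the branch of `log sinc` that vanishes at `0`. -/
def sincPow (s z : ℂ) : ℂ :=
  Complex.exp (-s * Complex.log (normSinc z))

/-- `sincAlpha n s` is the coefficient of `z ^ (2 n)` in the Taylor expansion of `sinc ^ (-s)` at
`0`, that is, `(sin (π z) / (π z)) ^ (-s) = ∑ n, sincAlpha n s * z ^ (2 n)`. -/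
def sincAlpha (n : ℕ) (s : ℂ) : ℂ :=
  iteratedDeriv (2 * n) (sincPow s) 0 / ((2 * n)! : ℂ)

/-- The coefficient `(1 / π) (1/2)_M / (2 ^ (2 M) M!)`, where `(a)_M` is the rising factorial. -/
def logCoeff (M : ℕ) : ℂ :=
  1 / (Real.pi : ℂ) * ((ascPochhammer ℂ M).eval (1 / 2) / (2 ^ (2 * M) * (M ! : ℂ)))

/-- The constant `G_M`. -/
def constG (M : ℕ) : ℂ :=
  logCoeff M *
    (deriv (sincAlpha M) (2 * M + 1) / sincAlpha M (2 * M + 1)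
      + 1 / 2 * Complex.digamma (M + 1)
      - 1 / 2 * Complex.digamma (M + 1 / 2)
      - (Real.log Real.pi : ℂ))

end

/-! Rotation invariance turns the energy into N·2^(-s) ∑ f(k/N) over 0 < k < N, with f(x) =
sin(πx)^(-s) (`rootsEnergy_eq`). For s = 2M+1 this is a Riemann sum of a function that is symmetric
under x ↦ 1-x and has a pole at each end. Its Laurent series at 0 is π^(-s) ∑ α_n(s) x^(2n-s).

Write p = M+q. Subtracting the Laurent terms with n ≤ p at both ends leaves a function analytic on
[0,1], to which Euler–Maclaurin applies. Each subtracted power e = 2n-s has its own expansion of ∑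
(k/N)^e, with constant ζ(-e), or γ with main term log N when e = -1, that is n = M. These give the
zeta terms and the logarithm (`hasPowSumExpansion_cscExp`). The boundary terms of both kinds cancel
by parity and by the vanishing of odd Bernoulli numbers, up to order N^(-(2q+1))
(`exists_cscPow_sum_bound`).

The remaining N² coefficient comes from the Hadamard finite part of ∫ f, which is -2 times the
constant term `cscConst M` at 0 of the antiderivative odd about 1/2
(`integral_reflectGlue_regPart`). The identity (csc^s)'' = π²(s(s+1) csc^(s+2) - s² csc^s), with csc
taken at πx, yields a recursion in M for this constant and, on coefficients, `sincAlpha_recurrence`.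
Differentiating the latter in s at 2M+1 shows that the digamma formula for G_M obeys the same
recursion (`neg_cscConst`).

The formula for α_n' comes from sinc^(-(s+t)) = sinc^(-s) sinc^(-t): differentiate the Cauchy
product at t = 0 and use -log sinc = ∑ ζ(2j) z^(2j)/j, a form of the partial fractions of the
cotangent. -/

noncomputable section

/-! ### Power series of sinc^(-s) and the derivative of its coefficients in s -/

section

open Topology PowerSeries

/-- The Taylor series at `0` of a function, as a formal power series. -/
def taylorPS (g : ℂ → ℂ) : PowerSeries ℂ :=
  PowerSeries.mk fun k => iteratedDeriv k g 0 / (k ! : ℂ)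

theorem coeff_taylorPS (g : ℂ → ℂ) (k : ℕ) :
    coeff k (taylorPS g) = iteratedDeriv k g 0 / (k ! : ℂ) := by
  simp [taylorPS]

theorem taylorPS_congr {f g : ℂ → ℂ} (h : f =ᶠ[𝓝 0] g) : taylorPS f = taylorPS g := by
  ext k
  rw [coeff_taylorPS, coeff_taylorPS, h.iteratedDeriv_eq]

theorem taylorPS_add {f g : ℂ → ℂ} (hf : AnalyticAt ℂ f 0) (hg : AnalyticAt ℂ g 0) :
    taylorPS (fun z => f z + g z) = taylorPS f + taylorPS g := by
  ext k
  rw [map_add, coeff_taylorPS, coeff_taylorPS, coeff_taylorPS, ← add_div,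
    ← iteratedDeriv_add hf.contDiffAt hg.contDiffAt]
  rfl

theorem taylorPS_const_mul (c : ℂ) (f : ℂ → ℂ) :
    taylorPS (fun z => c * f z) = C c * taylorPS f := by
  ext k
  rw [coeff_C_mul, coeff_taylorPS, coeff_taylorPS, iteratedDeriv_const_mul_field, mul_div_assoc]

theorem taylorPS_mul {f g : ℂ → ℂ} (hf : AnalyticAt ℂ f 0) (hg : AnalyticAt ℂ g 0) :
    taylorPS (fun z => f z * g z) = taylorPS f * taylorPS g := by
  ext k
  rw [coeff_mul, Finset.Nat.sum_antidiagonal_eq_sum_range_succ_mk, coeff_taylorPS,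
    show (fun z => f z * g z) = f * g from rfl,
    iteratedDeriv_mul hf.contDiffAt hg.contDiffAt, Finset.sum_div]
  refine Finset.sum_congr rfl fun i hi => ?_
  have hik : i ≤ k := Nat.lt_succ_iff.mp (Finset.mem_range.mp hi)
  rw [coeff_taylorPS, coeff_taylorPS, Nat.cast_choose ℂ hik]
  have h1 : (k ! : ℂ) ≠ 0 := by exact_mod_cast k.factorial_ne_zero
  have h2 : (i ! : ℂ) ≠ 0 := by exact_mod_cast i.factorial_ne_zero
  have h3 : ((k - i)! : ℂ) ≠ 0 := by exact_mod_cast (k - i).factorial_ne_zero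
  field_simp

theorem taylorPS_deriv (f : ℂ → ℂ) : taylorPS (deriv f) = d⁄dX ℂ (taylorPS f) := by
  ext k
  rw [coeff_derivative, coeff_taylorPS, coeff_taylorPS, iteratedDeriv_succ', Nat.factorial_succ]
  have h1 : (k ! : ℂ) ≠ 0 := by exact_mod_cast k.factorial_ne_zero
  have h2 : (k : ℂ) + 1 ≠ 0 := by exact_mod_cast k.succ_ne_zero
  push_cast
  field_simp

theorem taylorPS_id : taylorPS (fun z => z) = X := by
  ext k
  rw [coeff_taylorPS, iteratedDeriv_fun_id_zero, coeff_X]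
  by_cases h : k = 1 <;> simp [h]

theorem taylorPS_const (c : ℂ) : taylorPS (fun _ => c) = C c := by
  ext k
  rw [coeff_taylorPS, iteratedDeriv_const, coeff_C]
  by_cases h : k = 0 <;> simp [h]

theorem coeff_taylorPS_of_hasSum {f : ℂ → ℂ} {c : ℕ → ℂ}
    (h : ∀ᶠ z in 𝓝 (0 : ℂ), HasSum (fun n => z ^ n * c n) (f z)) (k : ℕ) :
    coeff k (taylorPS f) = c k := by
  have h1 : HasFPowerSeriesAt f (FormalMultilinearSeries.ofScalars ℂ c) 0 := by
    rw [hasFPowerSeriesAt_iff]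
    filter_upwards [h] with z hz
    simpa [FormalMultilinearSeries.coeff_ofScalars] using hz
  have h2 := h1.eq_formalMultilinearSeries h1.analyticAt.hasFPowerSeriesAt
  have h3 := congrArg (fun p => FormalMultilinearSeries.coeff p k) h2
  simp only [FormalMultilinearSeries.coeff_ofScalars] at h3
  rw [coeff_taylorPS, h3]

/-- The divided slope of an entire function is entire, so this form removes the singularity at 0. -/
theorem normSinc_eq_dslope (z : ℂ) : normSinc z = dslope Complex.sin 0 (Real.pi * z) := by
  have hpi : (Real.pi : ℂ) ≠ 0 := by exact_mod_cast Real.pi_ne_zero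
  rw [normSinc]
  split_ifs with h
  · simp [h, dslope_same]
  · rw [dslope_of_ne _ (mul_ne_zero hpi h), slope_def_field]
    simp

theorem differentiable_normSinc : Differentiable ℂ normSinc := by
  have h1 : DifferentiableOn ℂ (dslope Complex.sin 0) Set.univ :=
    (Complex.differentiableOn_dslope Filter.univ_mem).2 Complex.differentiable_sin.differentiableOn
  have h2 : normSinc = fun z => dslope Complex.sin 0 (Real.pi * z) :=
    funext normSinc_eq_dslope
  rw [h2]
  exact (differentiableOn_univ.1 h1).comp (differentiable_id.const_mul _)

theorem analyticAt_normSinc (z : ℂ) : AnalyticAt ℂ normSinc z :=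
  differentiable_normSinc.analyticAt z

theorem normSinc_zero : normSinc 0 = 1 := by simp [normSinc]

theorem pi_mul_normSinc (z : ℂ) : Real.pi * z * normSinc z = Complex.sin (Real.pi * z) := by
  have hpi : (Real.pi : ℂ) ≠ 0 := by exact_mod_cast Real.pi_ne_zero
  rw [normSinc]
  split_ifs with h
  · simp [h]
  · field_simp

theorem normSinc_neg (z : ℂ) : normSinc (-z) = normSinc z := by
  rw [normSinc, normSinc]
  by_cases h : z = 0
  · simp [h]
  · simp [h, Complex.sin_neg]

theorem normSinc_ne_zero {z : ℂ} (hz : ‖z‖ < 1) : normSinc z ≠ 0 := by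
  by_cases h : z = 0
  · simp [h, normSinc]
  · rw [normSinc, if_neg h]
    have hpi : (Real.pi : ℂ) ≠ 0 := by exact_mod_cast Real.pi_ne_zero
    refine div_ne_zero (fun h0 => ?_) (mul_ne_zero hpi h)
    obtain ⟨k, hk⟩ := Complex.sin_eq_zero_iff.1 h0
    have h1 : z = k := by
      apply mul_left_cancel₀ hpi
      rw [hk, mul_comm]
    rw [h1, Complex.norm_intCast] at hz
    have h2 : |k| < 1 := by exact_mod_cast hz
    rw [Int.abs_lt_one_iff.1 h2] at h1
    exact h (by simpa using h1)

theorem normSinc_mem_slitPlane : ∀ᶠ z in 𝓝 (0 : ℂ), normSinc z ∈ Complex.slitPlane := by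
  have h := (analyticAt_normSinc 0).continuousAt
  refine h.eventually (Complex.isOpen_slitPlane.mem_nhds ?_)
  rw [normSinc_zero]
  exact Complex.one_mem_slitPlane

theorem analyticAt_log_normSinc : AnalyticAt ℂ (fun z => Complex.log (normSinc z)) 0 :=
  (analyticAt_normSinc 0).clog (by rw [normSinc_zero]; exact Complex.one_mem_slitPlane)

theorem analyticAt_sincPow (s : ℂ) : AnalyticAt ℂ (sincPow s) 0 :=
  (analyticAt_const.mul analyticAt_log_normSinc).cexp

theorem sincPow_add (s t z : ℂ) : sincPow (s + t) z = sincPow s z * sincPow t z := by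
  rw [sincPow, sincPow, sincPow, ← Complex.exp_add]
  ring_nf

theorem sincPow_natCast (k : ℕ) {z : ℂ} (hz : normSinc z ≠ 0) :
    sincPow k z = (normSinc z ^ k)⁻¹ := by
  rw [sincPow, neg_mul, Complex.exp_neg, Complex.exp_nat_mul, Complex.exp_log hz]

theorem sincPow_neg (s z : ℂ) : sincPow s (-z) = sincPow s z := by
  rw [sincPow, sincPow, normSinc_neg]

theorem coeff_taylorPS_even (s : ℂ) (n : ℕ) :
    coeff (2 * n) (taylorPS (sincPow s)) = sincAlpha n s := by
  rw [coeff_taylorPS, sincAlpha]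

theorem coeff_taylorPS_odd (s : ℂ) (n : ℕ) :
    coeff (2 * n + 1) (taylorPS (sincPow s)) = 0 := by
  have h := iteratedDeriv_comp_neg (2 * n + 1) (sincPow s) 0
  simp only [sincPow_neg, neg_zero, pow_succ, pow_mul] at h
  norm_num at h
  have h2 : iteratedDeriv (2 * n + 1) (sincPow s) 0 = 0 := by
    have := self_eq_neg.1 h
    exact this
  rw [coeff_taylorPS, h2, zero_div]

theorem taylorPS_sincPow_add (s t : ℂ) :
    taylorPS (sincPow (s + t)) = taylorPS (sincPow s) * taylorPS (sincPow t) := by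
  rw [← taylorPS_mul (analyticAt_sincPow s) (analyticAt_sincPow t)]
  exact taylorPS_congr (Eventually.of_forall (sincPow_add s t))

/-- The logarithmic derivative of `1 / normSinc`. -/
def negLogDerivSinc (z : ℂ) : ℂ := -(deriv normSinc z / normSinc z)

theorem analyticAt_negLogDerivSinc : AnalyticAt ℂ negLogDerivSinc 0 :=
  ((analyticAt_normSinc 0).deriv.div (analyticAt_normSinc 0) (by simp [normSinc_zero])).neg

theorem deriv_sincPow (s : ℂ) {z : ℂ} (hz : normSinc z ∈ Complex.slitPlane) :
    HasDerivAt (sincPow s) (s * (negLogDerivSinc z * sincPow s z)) z := by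
  have h1 := ((differentiable_normSinc z).hasDerivAt.clog hz).const_mul (-s)
  have h2 := h1.cexp
  refine h2.congr_deriv ?_
  rw [negLogDerivSinc, sincPow]
  ring

/-- The first-order equation u' = s·w·u, with w = -sinc'/sinc independent of s, carries all
dependence on s: comparing coefficients determines them recursively as polynomials in s. -/
theorem taylorPS_sincPow_ode (s : ℂ) :
    d⁄dX ℂ (taylorPS (sincPow s)) = C s * (taylorPS negLogDerivSinc * taylorPS (sincPow s)) := by
  rw [← taylorPS_deriv, ← taylorPS_mul analyticAt_negLogDerivSinc (analyticAt_sincPow s),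
    ← taylorPS_const_mul]
  refine taylorPS_congr ?_
  filter_upwards [normSinc_mem_slitPlane] with z hz
  exact (deriv_sincPow s hz).deriv

theorem coeff_sincPow_succ (s : ℂ) (k : ℕ) :
    coeff (k + 1) (taylorPS (sincPow s)) * (k + 1) =
      s * ∑ p ∈ Finset.HasAntidiagonal.antidiagonal k,
        coeff p.1 (taylorPS negLogDerivSinc) * coeff p.2 (taylorPS (sincPow s)) := by
  rw [← coeff_derivative, taylorPS_sincPow_ode, coeff_C_mul, coeff_mul]

theorem coeff_zero_sincPow (s : ℂ) : coeff 0 (taylorPS (sincPow s)) = 1 := by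
  simp [coeff_taylorPS, sincPow, normSinc_zero]

theorem taylorPS_sincPow_zero : taylorPS (sincPow 0) = 1 := by
  rw [taylorPS_congr (g := fun _ => 1), taylorPS_const, map_one]
  exact Eventually.of_forall fun z => by simp [sincPow]

theorem differentiable_coeff_sincPow (k : ℕ) :
    Differentiable ℂ fun s => coeff k (taylorPS (sincPow s)) := by
  induction k using Nat.strong_induction_on with
  | _ k ih =>
    cases k with
    | zero => simp only [coeff_zero_sincPow]; fun_prop
    | succ k =>
      have h2 : (k : ℂ) + 1 ≠ 0 := by exact_mod_cast k.succ_ne_zero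
      have h : (fun s => coeff (k + 1) (taylorPS (sincPow s))) = fun s =>
          (s * ∑ p ∈ Finset.HasAntidiagonal.antidiagonal k,
            coeff p.1 (taylorPS negLogDerivSinc) * coeff p.2 (taylorPS (sincPow s))) / (k + 1) := by
        funext s
        rw [eq_div_iff h2, coeff_sincPow_succ]
      rw [h]
      refine (differentiable_id.mul (Differentiable.fun_sum fun p hp => ?_)).div_const _
      exact (ih p.2 (by have := Finset.HasAntidiagonal.mem_antidiagonal.1 hp; omega)).const_mul _

theorem differentiable_sincAlpha (n : ℕ) : Differentiable ℂ (sincAlpha n) := by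
  have h := differentiable_coeff_sincPow (2 * n)
  simpa only [coeff_taylorPS_even] using h

theorem hasDerivAt_coeff_sincPow_zero (k : ℕ) :
    HasDerivAt (fun s => coeff (k + 1) (taylorPS (sincPow s)))
      (coeff k (taylorPS negLogDerivSinc) / (k + 1)) 0 := by
  have h2 : (k : ℂ) + 1 ≠ 0 := by exact_mod_cast k.succ_ne_zero
  have h : (fun s => coeff (k + 1) (taylorPS (sincPow s))) = fun s =>
      (s * ∑ p ∈ Finset.HasAntidiagonal.antidiagonal k,
        coeff p.1 (taylorPS negLogDerivSinc) * coeff p.2 (taylorPS (sincPow s))) / (k + 1) := by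
    funext s
    rw [eq_div_iff h2, coeff_sincPow_succ]
  have h3 : Differentiable ℂ fun s => ∑ p ∈ Finset.HasAntidiagonal.antidiagonal k,
        coeff p.1 (taylorPS negLogDerivSinc) * coeff p.2 (taylorPS (sincPow s)) :=
    Differentiable.fun_sum fun p _ => (differentiable_coeff_sincPow p.2).const_mul _
  have h4 := (((hasDerivAt_id (0 : ℂ)).mul (h3 0).hasDerivAt).div_const ((k : ℂ) + 1))
  rw [h]
  refine h4.congr_deriv ?_
  -- The product rule leaves only the value of the convolution at s = 0. There sinc^0 = 1, so it
  -- collapses to a single coefficient.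
  have h5 := congrArg (coeff k) (mul_one (taylorPS negLogDerivSinc))
  rw [← taylorPS_sincPow_zero, coeff_mul] at h5
  rw [h5]
  simp

/-! ### Even zeta values from the cotangent series -/

theorem mem_integerComplement_of_norm_lt_one {z : ℂ} (hz : ‖z‖ < 1) (hz0 : z ≠ 0) :
    z ∈ Complex.integerComplement := by
  rw [Complex.mem_integerComplement_iff]
  rintro ⟨n, rfl⟩
  rw [Complex.norm_intCast] at hz
  have h2 : |n| < 1 := by exact_mod_cast hz
  rw [Int.abs_lt_one_iff.1 h2] at hz0
  simp at hz0

/-- Differentiate πz·sinc z = sin πz. Avoiding the quotient makes the identity valid at 0, so that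
it passes to power series. -/
theorem normSinc_add_mul_deriv (z : ℂ) :
    normSinc z + z * deriv normSinc z = Complex.cos (Real.pi * z) := by
  have hpi : (Real.pi : ℂ) ≠ 0 := by exact_mod_cast Real.pi_ne_zero
  have hd : HasDerivAt (fun z => Real.pi * z * normSinc z)
      (Real.pi * normSinc z + Real.pi * z * deriv normSinc z) z := by
    have := ((hasDerivAt_id' z).const_mul (Real.pi : ℂ)).fun_mul
      (differentiable_normSinc z).hasDerivAt
    simpa using this
  have hd2 : HasDerivAt (fun z => Complex.sin (Real.pi * z))
      (Complex.cos (Real.pi * z) * Real.pi) z := by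
    have := ((hasDerivAt_id z).const_mul (Real.pi : ℂ)).csin
    simpa using this
  simp only [pi_mul_normSinc] at hd
  have e := hd.unique hd2
  apply mul_left_cancel₀ hpi
  linear_combination e

theorem negLogDerivSinc_eq_cot {z : ℂ} (hz : ‖z‖ < 1) (hz0 : z ≠ 0) :
    negLogDerivSinc z = -(Real.pi * Complex.cot (Real.pi * z) - 1 / z) := by
  have hpi : (Real.pi : ℂ) ≠ 0 := by exact_mod_cast Real.pi_ne_zero
  have hs : Complex.sin (Real.pi * z) ≠ 0 := by
    rw [← pi_mul_normSinc]
    exact mul_ne_zero (mul_ne_zero hpi hz0) (normSinc_ne_zero hz)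
  have e' := normSinc_add_mul_deriv z
  rw [negLogDerivSinc, Complex.cot_eq_cos_div_sin]
  have hn := normSinc_ne_zero hz
  have e2 := pi_mul_normSinc z
  rw [← e2]
  field_simp
  linear_combination -e'

theorem norm_natCast_add_one (n : ℕ) : ‖(n : ℂ) + 1‖ = n + 1 := by
  rw [show (n : ℂ) + 1 = ((n + 1 : ℕ) : ℂ) by push_cast; ring, Complex.norm_natCast]
  push_cast; ring

/-- Each partial fraction equals 2z/((n+1)² - z²), a geometric series in z²/(n+1)². -/
theorem hasSum_neg_cotTerm {z : ℂ} (hz : ‖z‖ < 1) (hz0 : z ≠ 0) (n : ℕ) :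
    HasSum (fun j : ℕ => 2 * z ^ (2 * j + 1) / ((n : ℂ) + 1) ^ (2 * (j + 1)))
      (-cotTerm z n) := by
  have hmem := mem_integerComplement_of_norm_lt_one hz hz0
  have hsq : ∀ n : ℕ, ‖z ^ 2 / ((n : ℂ) + 1) ^ 2‖ < 1 := by
    intro n
    have : (1 : ℝ) ≤ (n : ℝ) + 1 := by linarith [n.cast_nonneg (α := ℝ)]
    rw [← div_pow, norm_pow, norm_div]
    have hn : ‖(n : ℂ) + 1‖ = n + 1 := norm_natCast_add_one n
    rw [hn]
    have h0 : ‖z‖ / (n + 1) < 1 := by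
      rw [div_lt_one (by linarith)]; linarith
    exact pow_lt_one₀ (by positivity) h0 two_ne_zero
  have hn0 : (n : ℂ) + 1 ≠ 0 := by exact_mod_cast n.succ_ne_zero
  have hg := (hasSum_geometric_of_norm_lt_one (hsq n)).mul_left (2 * z / ((n : ℂ) + 1) ^ 2)
  have e0 : (1 - z ^ 2 / ((n : ℂ) + 1) ^ 2) ≠ 0 := by
    intro h
    have := hsq n
    rw [← sub_eq_zero.1 h] at this
    simp at this
  have e1 : ((n : ℂ) + 1) ^ 2 - z ^ 2 ≠ 0 := by
    intro h
    apply e0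
    rw [← sub_eq_zero.1 h, div_self (pow_ne_zero 2 hn0), sub_self]
  have e2 : z + (n + 1) ≠ 0 := fun h => e1 (by linear_combination (n + 1 - z) * h)
  have e3 : z - (n + 1) ≠ 0 := fun h => e1 (by linear_combination -(n + 1 + z) * h)
  convert! hg using 1
  · funext j
    rw [div_pow, ← pow_mul, ← pow_mul, show 2 * (j + 1) = 2 + 2 * j by ring, pow_add ((n : ℂ) + 1),
      pow_succ z, div_mul_div_comm]
    ring
  · rw [cotTerm_identity hmem]
    rw [← div_eq_mul_inv]
    field_simp
    ring

theorem summable_cot_double_series {z : ℂ} (hz : ‖z‖ < 1) :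
    Summable fun q : ℕ × ℕ =>
      2 * z ^ (2 * q.2 + 1) / ((q.1 : ℂ) + 1) ^ (2 * (q.2 + 1)) := by
  have hb : Summable fun q : ℕ × ℕ =>
      (1 / ((q.1 : ℝ) + 1) ^ 2) * (2 * ‖z‖ * (‖z‖ ^ 2) ^ q.2) := by
    have s1 : Summable fun n : ℕ => 1 / ((n : ℝ) + 1) ^ 2 := by
      have := (summable_nat_add_iff 1).2 (Real.summable_one_div_nat_pow.2 one_lt_two)
      simpa using this
    have s2 : Summable fun n : ℕ => 2 * ‖z‖ * (‖z‖ ^ 2) ^ n :=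
      (summable_geometric_of_lt_one (by positivity)
        (pow_lt_one₀ (norm_nonneg z) hz two_ne_zero)).mul_left _
    exact s1.mul_of_nonneg s2 (fun n => by positivity) (fun n => by positivity)
  refine hb.of_norm_bounded fun q => ?_
  have : (1 : ℝ) ≤ (q.1 : ℝ) + 1 := by linarith [q.1.cast_nonneg (α := ℝ)]
  have hn : ‖(q.1 : ℂ) + 1‖ = q.1 + 1 := norm_natCast_add_one q.1
  rw [norm_div, norm_mul, norm_pow, norm_pow, hn]
  have e : ‖(2 : ℂ)‖ * ‖z‖ ^ (2 * q.2 + 1) / ((q.1 : ℝ) + 1) ^ (2 * (q.2 + 1)) =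
      (1 / ((q.1 : ℝ) + 1) ^ (2 * (q.2 + 1))) * (2 * ‖z‖ * (‖z‖ ^ 2) ^ q.2) := by
    rw [Complex.norm_ofNat]; ring
  rw [e]
  refine mul_le_mul_of_nonneg_right ?_ (by positivity)
  exact one_div_le_one_div_of_le (by positivity) (pow_le_pow_right₀ this (by omega))

/-- The Mittag-Leffler series of the cotangent becomes an absolutely convergent double series.
Summing it first over the poles produces the zeta values. -/
theorem hasSum_negLogDerivSinc {z : ℂ} (hz : ‖z‖ < 1) (hz0 : z ≠ 0) :
    HasSum (fun j : ℕ => 2 * riemannZeta (2 * (j + 1)) * z ^ (2 * j + 1)) (negLogDerivSinc z) := by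
  have hmem := mem_integerComplement_of_norm_lt_one hz hz0
  have h1 := negLogDerivSinc_eq_cot hz hz0
  have hrow := hasSum_neg_cotTerm hz hz0
  have hnorm := summable_cot_double_series hz
  have htot : HasSum (fun q : ℕ × ℕ =>
      2 * z ^ (2 * q.2 + 1) / ((q.1 : ℂ) + 1) ^ (2 * (q.2 + 1))) (negLogDerivSinc z) := by
    have h3 := hnorm.hasSum.prod_fiberwise hrow
    have h4 : HasSum (fun n => -cotTerm z n) (negLogDerivSinc z) := by
      rw [h1, cot_series_rep' hmem]
      exact (summable_cotTerm hmem).hasSum.neg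
    rw [← h3.unique h4]
    exact hnorm.hasSum
  have hswap : HasSum (fun q : ℕ × ℕ =>
      2 * z ^ (2 * q.1 + 1) / ((q.2 : ℂ) + 1) ^ (2 * (q.1 + 1))) (negLogDerivSinc z) :=
    (Equiv.prodComm ℕ ℕ).hasSum_iff.2 htot
  refine hswap.prod_fiberwise fun j => ?_
  have hz1 : 1 < (2 * ((j : ℂ) + 1)).re := by
    simp
    linarith [j.cast_nonneg (α := ℝ)]
  have hsum : HasSum (fun n : ℕ => 1 / ((n : ℂ) + 1) ^ (2 * (j + 1)))
      (riemannZeta (2 * (j + 1))) := by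
    have e : (2 * ((j : ℂ) + 1)) = ((2 * (j + 1) : ℕ) : ℂ) := by push_cast; ring
    rw [zeta_eq_tsum_one_div_nat_add_one_cpow hz1]
    have : (fun n : ℕ => 1 / ((n : ℂ) + 1) ^ (2 * ((j : ℂ) + 1))) =
        fun n : ℕ => 1 / ((n : ℂ) + 1) ^ (2 * (j + 1)) := by
      funext n
      rw [e, Complex.cpow_natCast]
    rw [this]
    refine Summable.hasSum ?_
    have h5 : Summable fun n : ℕ => (1 : ℂ) / (n : ℂ) ^ (2 * (j + 1)) := by
      have := Complex.summable_one_div_nat_cpow.2 hz1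
      rw [e] at this
      simpa only [Complex.cpow_natCast] using this
    have h6 := (summable_nat_add_iff 1).2 h5
    simpa using h6
  have h7 := hsum.mul_left (2 * z ^ (2 * j + 1))
  convert! h7 using 1
  · funext n; ring
  · ring

theorem coeff_negLogDerivSinc_odd (j : ℕ) :
    coeff (2 * j + 1) (taylorPS negLogDerivSinc) = 2 * riemannZeta (2 * (j + 1)) := by
  have h := coeff_taylorPS_of_hasSum (f := negLogDerivSinc)
    (c := fun k => if k % 2 = 1 then 2 * riemannZeta (2 * (((k / 2 : ℕ) : ℂ) + 1)) else 0) ?_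
    (2 * j + 1)
  · rw [h, if_pos (by omega), show (2 * j + 1) / 2 = j by omega]
  · have h1 : ∀ᶠ z in 𝓝 (0 : ℂ), ‖z‖ < 1 := by
      have := Metric.ball_mem_nhds (0 : ℂ) one_pos
      filter_upwards [this] with z hz
      simpa using hz
    filter_upwards [h1] with z hz
    -- The cotangent formula excludes 0; there the value is 0 because sinc is even.
    by_cases hz0 : z = 0
    · subst hz0
      have e : negLogDerivSinc 0 = 0 := by
        have hd : deriv normSinc 0 = 0 := by
          have h2 := deriv_comp_neg normSinc 0
          simp only [normSinc_neg, neg_zero] at h2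
          exact self_eq_neg.1 h2
        rw [negLogDerivSinc, hd]
        simp
      rw [e]
      convert! hasSum_zero using 1
      funext k
      cases k <;> simp
    · have h2 := hasSum_negLogDerivSinc hz hz0
      have hinj : Function.Injective fun j : ℕ => 2 * j + 1 := fun a b h => by
        simp only at h; omega
      rw [← hinj.hasSum_iff]
      · convert! h2 using 1
        funext i
        simp only [Function.comp_apply]
        rw [if_pos (by omega), show (2 * i + 1) / 2 = i by omega]
        ring
      · intro k hk
        rw [if_neg, mul_zero]
        intro hodd
        exact hk ⟨k / 2, by simp only; omega⟩

theorem hasDerivAt_sincAlpha_zero (j : ℕ) :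
    HasDerivAt (sincAlpha (j + 1)) (riemannZeta (2 * (j + 1)) / (j + 1)) 0 := by
  have h := hasDerivAt_coeff_sincPow_zero (2 * j + 1)
  have e : (fun s => coeff (2 * j + 1 + 1) (taylorPS (sincPow s))) = sincAlpha (j + 1) :=
    funext fun s => coeff_taylorPS_even s (j + 1)
  rw [e, coeff_negLogDerivSinc_odd] at h
  refine h.congr_deriv ?_
  have h2 : (j : ℂ) + 1 ≠ 0 := by exact_mod_cast j.succ_ne_zero
  push_cast
  rw [show (2 * (j : ℂ) + 1 + 1) = 2 * (j + 1) by ring]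
  field_simp

theorem sincAlpha_zero_left (s : ℂ) : sincAlpha 0 s = 1 := by
  rw [← coeff_taylorPS_even, mul_zero, coeff_zero_sincPow]

/-- This is the Cauchy product of the two series, in which the odd coefficients vanish. -/
theorem sincAlpha_add (n : ℕ) (s t : ℂ) :
    sincAlpha n (s + t) = ∑ m ∈ Finset.range (n + 1), sincAlpha m s * sincAlpha (n - m) t := by
  rw [← coeff_taylorPS_even, taylorPS_sincPow_add, coeff_mul,
    Finset.Nat.sum_antidiagonal_eq_sum_range_succ_mk]
  symm
  refine Finset.sum_of_injOn (fun m => 2 * m) (fun a _ b _ h => by simpa using h) ?_ ?_ ?_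
  · intro m hm
    simp only [Finset.coe_range, Set.mem_Iio] at hm ⊢
    omega
  · intro k hk hk2
    simp only [Finset.mem_range] at hk
    have hodd : k % 2 = 1 := by
      by_contra hne
      refine hk2 ⟨k / 2, ?_, ?_⟩
      · simp only [Finset.coe_range, Set.mem_Iio]; omega
      · simp only; omega
    rw [show k = 2 * (k / 2) + 1 by omega, coeff_taylorPS_odd, zero_mul]
  · intro m hm
    rw [coeff_taylorPS_even, ← Nat.mul_sub, coeff_taylorPS_even]

/-- By the addition formula only the derivatives at exponent 0 matter. The top term has factor α_0 =
1 and is constant in t, hence it drops out. -/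
theorem hasDerivAt_sincAlpha (n : ℕ) (s : ℂ) :
    HasDerivAt (sincAlpha n)
      (∑ m ∈ Finset.range n,
        sincAlpha m s * (riemannZeta (2 * ((n : ℂ) - m)) / ((n : ℂ) - m))) s := by
  have h1 : HasDerivAt (fun t => sincAlpha n (s + t))
      (∑ m ∈ Finset.range n,
        sincAlpha m s * (riemannZeta (2 * ((n : ℂ) - m)) / ((n : ℂ) - m))) 0 := by
    simp only [sincAlpha_add, Finset.sum_range_succ, Nat.sub_self, sincAlpha_zero_left, mul_one]
    refine HasDerivAt.add_const _ (HasDerivAt.fun_sum fun m hm => ?_)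
    have hmn : m < n := Finset.mem_range.1 hm
    have h2 := hasDerivAt_sincAlpha_zero (n - m - 1)
    rw [show n - m - 1 + 1 = n - m by omega] at h2
    have e : ((n - m - 1 : ℕ) : ℂ) + 1 = n - m := by
      rw [← Nat.cast_sub hmn.le, show n - m = (n - m - 1) + 1 by omega]
      push_cast
      simp
    rw [e] at h2
    exact h2.const_mul _
  have h3 := HasDerivAt.comp_sub_const s s (f := fun t => sincAlpha n (s + t))
    (by rw [sub_self]; exact h1)
  simpa using h3

end

/-! ### The recurrence s → s+2 and the values at s = 2M+1 -/

section

open Topology PowerSeries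

theorem taylorPS_normSinc_ne_zero : taylorPS normSinc ≠ 0 := by
  intro h
  have h1 := congrArg (coeff 0) h
  simp [coeff_taylorPS, normSinc_zero] at h1

theorem taylorPS_cos_pi_mul :
    taylorPS (fun z => Complex.cos (Real.pi * z)) =
      taylorPS normSinc + X * d⁄dX ℂ (taylorPS normSinc) := by
  have hd := (analyticAt_normSinc 0).deriv
  rw [← taylorPS_deriv, ← taylorPS_id, ← taylorPS_mul (f := fun z => z) analyticAt_id hd,
    ← taylorPS_add (analyticAt_normSinc 0)
      (AnalyticAt.fun_mul (f := fun z => z) analyticAt_id hd)]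
  exact taylorPS_congr (Eventually.of_forall fun z => (normSinc_add_mul_deriv z).symm)

theorem taylorPS_sin_pi_mul :
    taylorPS (fun z => Complex.sin (Real.pi * z)) = C (Real.pi : ℂ) * (X * taylorPS normSinc) := by
  rw [← taylorPS_id, ← taylorPS_mul (f := fun z => z) analyticAt_id (analyticAt_normSinc 0),
    ← taylorPS_const_mul]
  refine taylorPS_congr (Eventually.of_forall fun z => ?_)
  simp only
  rw [← pi_mul_normSinc]
  simp [mul_assoc]

theorem derivative_taylorPS_cos_pi_mul :
    d⁄dX ℂ (taylorPS (fun z => Complex.cos (Real.pi * z))) =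
      -(C (Real.pi : ℂ) * taylorPS (fun z => Complex.sin (Real.pi * z))) := by
  rw [← taylorPS_deriv, ← neg_mul, ← map_neg, ← taylorPS_const_mul]
  refine taylorPS_congr (Eventually.of_forall fun z => ?_)
  have := (((hasDerivAt_id' z).const_mul (Real.pi : ℂ)).ccos).deriv
  simp only at this ⊢
  rw [this]
  ring

theorem taylorPS_cos_sq_add_sin_sq :
    taylorPS (fun z => Complex.cos (Real.pi * z)) ^ 2 +
      taylorPS (fun z => Complex.sin (Real.pi * z)) ^ 2 = 1 := by
  have hc : AnalyticAt ℂ (fun z => Complex.cos (Real.pi * z)) 0 := by fun_prop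
  have hs : AnalyticAt ℂ (fun z => Complex.sin (Real.pi * z)) 0 := by fun_prop
  rw [sq, sq, ← taylorPS_mul hc hc, ← taylorPS_mul hs hs,
    ← taylorPS_add (hc.fun_mul hc) (hs.fun_mul hs),
    ← map_one C, ← taylorPS_const]
  refine taylorPS_congr (Eventually.of_forall fun z => ?_)
  simp only
  rw [← sq, ← sq, Complex.cos_sq_add_sin_sq]

theorem normSinc_ne_zero_eventually : ∀ᶠ z in 𝓝 (0 : ℂ), normSinc z ≠ 0 := by
  filter_upwards [normSinc_mem_slitPlane] with z hz
  exact Complex.slitPlane_ne_zero hz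

theorem negLogDerivSinc_mul_normSinc :
    taylorPS negLogDerivSinc * taylorPS normSinc = -d⁄dX ℂ (taylorPS normSinc) := by
  rw [← taylorPS_mul analyticAt_negLogDerivSinc (analyticAt_normSinc 0), ← taylorPS_deriv,
    ← neg_one_mul, ← map_one C, ← map_neg, ← taylorPS_const_mul]
  refine taylorPS_congr ?_
  filter_upwards [normSinc_ne_zero_eventually] with z hz
  rw [negLogDerivSinc]
  field_simp

theorem taylorPS_sincPow_two_mul_sq : taylorPS (sincPow 2) * taylorPS normSinc ^ 2 = 1 := by
  have h := analyticAt_normSinc 0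
  rw [sq, ← taylorPS_mul h h, ← taylorPS_mul (analyticAt_sincPow 2) (h.fun_mul h), ← map_one C,
    ← taylorPS_const]
  refine taylorPS_congr ?_
  filter_upwards [normSinc_ne_zero_eventually] with z hz
  have := sincPow_natCast 2 hz
  rw [Nat.cast_ofNat] at this
  rw [this]
  field_simp

/-- For w = 1/z - π cot πz this is the Riccati equation of the cotangent, multiplied by z. It
follows from (cos πz)' = -π sin πz after cancelling the nonzero series of sinc. -/
theorem taylorPS_negLogDerivSinc_riccati :
    X * d⁄dX ℂ (taylorPS negLogDerivSinc) =
      C ((Real.pi : ℂ) ^ 2) * X - 2 * taylorPS negLogDerivSinc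
        + X * taylorPS negLogDerivSinc ^ 2 := by
  apply mul_right_cancel₀ taylorPS_normSinc_ne_zero
  have h1 := derivative_taylorPS_cos_pi_mul
  rw [taylorPS_cos_pi_mul, taylorPS_sin_pi_mul] at h1
  have h2 := negLogDerivSinc_mul_normSinc
  have h3 := congrArg (d⁄dX ℂ) h2
  simp only [map_add, map_neg, Derivation.leibniz, smul_eq_mul, derivative_X] at h1 h3
  rw [map_pow]
  linear_combination X * h3 - h1 + (-X * taylorPS negLogDerivSinc + 2) * h2

/-- Divide cos² + sin² = 1 by sinc², using cos πz = (1 - zw) sinc z. -/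
theorem taylorPS_sincPow_two :
    taylorPS (sincPow 2) =
      (1 - X * taylorPS negLogDerivSinc) ^ 2 + C ((Real.pi : ℂ) ^ 2) * X ^ 2 := by
  apply mul_right_cancel₀ (pow_ne_zero 2 taylorPS_normSinc_ne_zero)
  have h1 := taylorPS_cos_sq_add_sin_sq
  rw [taylorPS_cos_pi_mul, taylorPS_sin_pi_mul] at h1
  rw [taylorPS_sincPow_two_mul_sq, map_pow]
  have h2 := negLogDerivSinc_mul_normSinc
  have h4 : d⁄dX ℂ (taylorPS normSinc) = -(taylorPS negLogDerivSinc * taylorPS normSinc) := by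
    rw [h2, neg_neg]
  rw [h4] at h1
  linear_combination -h1

/-- This is the second-order identity for csc^s, rewritten for sinc^(-s) and cleared of powers of z.
Once the first-order equation is used twice, only the Riccati equation remains. -/
theorem taylorPS_sincPow_add_two (s : ℂ) :
    C (s * (s + 1)) * taylorPS (sincPow (s + 2)) =
      X ^ 2 * d⁄dX ℂ (d⁄dX ℂ (taylorPS (sincPow s)))
        - C (2 * s) * (X * d⁄dX ℂ (taylorPS (sincPow s)))
        + C (s * (s + 1)) * taylorPS (sincPow s)
        + C (s ^ 2 * (Real.pi : ℂ) ^ 2) * (X ^ 2 * taylorPS (sincPow s)) := by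
  have h1 := taylorPS_sincPow_ode s
  have h2 := congrArg (d⁄dX ℂ) h1
  simp only [Derivation.leibniz, smul_eq_mul, derivative_C] at h2
  have h3 := taylorPS_negLogDerivSinc_riccati
  rw [taylorPS_sincPow_add, taylorPS_sincPow_two, h2, h1]
  simp only [map_mul, map_add, map_pow, map_one, map_ofNat] at h3 ⊢
  linear_combination (-C s * X * taylorPS (sincPow s)) * h3

theorem sincAlpha_recurrence (n : ℕ) (s : ℂ) :
    s * (s + 1) * sincAlpha (n + 1) (s + 2) =
      (2 * (n + 1) - s) * (2 * (n + 1) - s - 1) * sincAlpha (n + 1) s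
        + s ^ 2 * (Real.pi : ℂ) ^ 2 * sincAlpha n s := by
  have h := congrArg (coeff (2 * n + 2)) (taylorPS_sincPow_add_two s)
  simp only [map_add, map_sub, coeff_C_mul, coeff_X_pow_mul, coeff_derivative] at h
  rw [show 2 * n + 2 = (2 * n + 1) + 1 by ring, coeff_succ_X_mul, coeff_derivative,
    show 2 * n + 1 + 1 = 2 * (n + 1) by ring, coeff_taylorPS_even, coeff_taylorPS_even,
    coeff_taylorPS_even] at h
  push_cast at h
  linear_combination h

/-- At n = M and s = 2M+1 the factor 2(n+1) - s - 1 vanishes, so the recurrence links only the two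
diagonal values. -/
theorem sincAlpha_self_succ (M : ℕ) :
    (2 * (M : ℂ) + 2) * sincAlpha (M + 1) (2 * ((M + 1 : ℕ) : ℂ) + 1) =
      (2 * M + 1) * (Real.pi : ℂ) ^ 2 * sincAlpha M (2 * M + 1) := by
  have h := sincAlpha_recurrence M (2 * M + 1)
  have h0 : 2 * (M : ℂ) + 1 ≠ 0 := by exact_mod_cast (2 * M).succ_ne_zero
  apply mul_left_cancel₀ h0
  rw [show 2 * ((M + 1 : ℕ) : ℂ) + 1 = 2 * M + 1 + 2 by push_cast; ring]
  linear_combination h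

theorem sincAlpha_self (M : ℕ) :
    sincAlpha M (2 * M + 1) =
      (Real.pi : ℂ) ^ (2 * M) * (ascPochhammer ℂ M).eval (1 / 2) / (M ! : ℂ) := by
  induction M with
  | zero => simp [sincAlpha_zero_left]
  | succ M ih =>
    have h := sincAlpha_self_succ M
    have h1 : (M : ℂ) + 1 ≠ 0 := by exact_mod_cast M.succ_ne_zero
    have h2 : (M ! : ℂ) ≠ 0 := by exact_mod_cast M.factorial_ne_zero
    rw [ih] at h
    have h3 : 2 * (M : ℂ) + 2 ≠ 0 := by
      rw [show 2 * (M : ℂ) + 2 = 2 * (M + 1) by ring]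
      exact mul_ne_zero two_ne_zero h1
    apply mul_left_cancel₀ h3
    rw [h, ascPochhammer_succ_eval, Nat.factorial_succ]
    push_cast
    field_simp
    ring

theorem sincAlpha_self_ne_zero (M : ℕ) : sincAlpha M (2 * M + 1) ≠ 0 := by
  induction M with
  | zero => simp [sincAlpha_zero_left]
  | succ M ih =>
    intro h0
    have h := sincAlpha_self_succ M
    rw [h0, mul_zero] at h
    have hpi : (Real.pi : ℂ) ≠ 0 := by exact_mod_cast Real.pi_ne_zero
    have h1 : 2 * (M : ℂ) + 1 ≠ 0 := by exact_mod_cast (2 * M).succ_ne_zero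
    exact mul_ne_zero (mul_ne_zero h1 (pow_ne_zero 2 hpi)) ih h.symm

theorem logCoeff_eq (M : ℕ) :
    logCoeff M = 2 * sincAlpha M (2 * M + 1) / (2 * Real.pi : ℂ) ^ (2 * M + 1) := by
  have hpi : (Real.pi : ℂ) ≠ 0 := by exact_mod_cast Real.pi_ne_zero
  have h2 : (M ! : ℂ) ≠ 0 := by exact_mod_cast M.factorial_ne_zero
  rw [logCoeff, sincAlpha_self, mul_pow, pow_succ 2, pow_succ (Real.pi : ℂ)]
  field_simp

/-- Logarithmic differentiation of the recurrence in s. The factor 2(M+1) - s - 1 vanishes at s =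
2M+1 but its derivative is -1, which is why the off-diagonal value α_(M+1)(2M+1) enters. -/
theorem deriv_sincAlpha_self_succ (M : ℕ) :
    deriv (sincAlpha (M + 1)) (2 * ((M + 1 : ℕ) : ℂ) + 1)
        / sincAlpha (M + 1) (2 * ((M + 1 : ℕ) : ℂ) + 1) =
      deriv (sincAlpha M) (2 * M + 1) / sincAlpha M (2 * M + 1)
        + 1 / (2 * M + 1) - 1 / (2 * M + 2)
        - sincAlpha (M + 1) (2 * M + 1)
          / ((2 * M + 1) ^ 2 * (Real.pi : ℂ) ^ 2 * sincAlpha M (2 * M + 1)) := by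
  set s : ℂ := 2 * M + 1 with hs
  have hpi : (Real.pi : ℂ) ≠ 0 := by exact_mod_cast Real.pi_ne_zero
  have hM0 : sincAlpha M s ≠ 0 := sincAlpha_self_ne_zero M
  have hs0 : s ≠ 0 := by rw [hs]; exact_mod_cast (2 * M).succ_ne_zero
  have hs1 : s + 1 ≠ 0 := by rw [hs]; exact_mod_cast (2 * M + 1).succ_ne_zero
  have e1 : 2 * ((M + 1 : ℕ) : ℂ) + 1 = s + 2 := by rw [hs]; push_cast; ring
  have hMM := sincAlpha_self_succ M
  rw [e1, ← hs, show 2 * (M : ℂ) + 2 = s + 1 by rw [hs]; ring] at hMM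
  have d0 := (differentiable_sincAlpha M s).hasDerivAt
  have d1 := (differentiable_sincAlpha (M + 1) s).hasDerivAt
  have d2 : HasDerivAt (fun t => sincAlpha (M + 1) (t + 2)) (deriv (sincAlpha (M + 1)) (s + 2)) s :=
    (differentiable_sincAlpha (M + 1) (s + 2)).hasDerivAt.comp_add_const s 2
  have hid := hasDerivAt_id' s
  have L := (hid.fun_mul (hid.add_const 1)).fun_mul d2
  have R := ((((hid.const_sub (2 * ((M : ℂ) + 1))).fun_mul
    ((hid.const_sub (2 * ((M : ℂ) + 1))).sub_const 1)).fun_mul d1)).fun_add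
    (((hid.fun_pow 2).mul_const ((Real.pi : ℂ) ^ 2)).fun_mul d0)
  simp only [sincAlpha_recurrence] at L
  have key := L.unique R
  have e3 : (M : ℂ) = (s - 1) / 2 := by rw [hs]; ring
  rw [e1, show 2 * (M : ℂ) + 2 = s + 1 by rw [hs]; ring]
  rw [e3] at key
  have hA : sincAlpha (M + 1) (s + 2) = s * (Real.pi : ℂ) ^ 2 * sincAlpha M s / (s + 1) := by
    field_simp; linear_combination hMM
  rw [hA] at key ⊢
  field_simp at key ⊢
  ring_nf at key ⊢
  linear_combination key

end

/-! ### Euler–Maclaurin summation -/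

section

open Topology

/-- The Euler-Maclaurin coefficient `B_{j+1} / (j+1)!`. -/
def emCoeff (j : ℕ) : ℂ := (bernoulli (j + 1) : ℂ) / ((j + 1)! : ℂ)

/-- The Euler-Maclaurin boundary term at `x` of a function with iterated derivatives `G j`. -/
def emBdry (J : ℕ) (G : ℕ → ℝ → ℂ) (x : ℝ) : ℂ := ∑ j ∈ Finset.range J, emCoeff j * G j x

/-- The integral `∫ B_j(t) / j! G_j(a + t)` over the unit interval. -/
def emIntegral (G : ℕ → ℝ → ℂ) (a : ℝ) (j : ℕ) : ℂ :=
  ∫ t in (0 : ℝ)..1, ((bernoulliFun j t : ℂ) / (j ! : ℂ)) * G j (a + t)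

theorem emCoeff_eq_zero {j : ℕ} (h : Even j) (h0 : j ≠ 0) : emCoeff j = 0 := by
  rw [emCoeff, bernoulli_eq_zero_of_odd h.add_one (by omega)]
  simp

theorem emCoeff_zero : emCoeff 0 = -1 / 2 := by
  simp [emCoeff, bernoulli_one]

/-- Integration by parts, with B_(j+1)/(j+1)! as antiderivative of B_j/j!. -/
theorem emIntegral_step {G : ℕ → ℝ → ℂ} {a : ℝ} {j : ℕ}
    (hd : ∀ x ∈ Set.Icc a (a + 1), HasDerivAt (G j) (G (j + 1) x) x)
    (hc : ContinuousOn (G (j + 1)) (Set.Icc a (a + 1))) :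
    emIntegral G a j = ((bernoulliFun (j + 1) 1 : ℂ) / ((j + 1)! : ℂ)) * G j (a + 1)
      - ((bernoulliFun (j + 1) 0 : ℂ) / ((j + 1)! : ℂ)) * G j a - emIntegral G a (j + 1) := by
  have hmem : ∀ t ∈ Set.uIcc (0 : ℝ) 1, a + t ∈ Set.Icc a (a + 1) := by
    intro t ht
    rw [Set.uIcc_of_le zero_le_one] at ht
    exact ⟨by linarith [ht.1], by linarith [ht.2]⟩
  have hu : ∀ t ∈ Set.uIcc (0 : ℝ) 1,
      HasDerivAt (fun t : ℝ => (bernoulliFun (j + 1) t : ℂ) / ((j + 1)! : ℂ))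
        ((bernoulliFun j t : ℂ) / (j ! : ℂ)) t := by
    intro t _
    have h := ((hasDerivAt_bernoulliFun (j + 1) t).ofReal_comp).div_const ((j + 1)! : ℂ)
    refine h.congr_deriv ?_
    rw [Nat.factorial_succ, Nat.add_sub_cancel]
    have h1 : (j ! : ℂ) ≠ 0 := by exact_mod_cast j.factorial_ne_zero
    have h2 : (j : ℂ) + 1 ≠ 0 := by exact_mod_cast j.succ_ne_zero
    push_cast
    field_simp
  have hv : ∀ t ∈ Set.uIcc (0 : ℝ) 1,
      HasDerivAt (fun t : ℝ => G j (a + t)) (G (j + 1) (a + t)) t := by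
    intro t ht
    exact (hd _ (hmem t ht)).comp_const_add a t
  have hu' : Continuous fun t : ℝ => (bernoulliFun j t : ℂ) / (j ! : ℂ) := by fun_prop
  have hv' : ContinuousOn (fun t : ℝ => G (j + 1) (a + t)) (Set.uIcc 0 1) :=
    hc.comp (by fun_prop) hmem
  have h := intervalIntegral.integral_mul_deriv_eq_deriv_mul hu hv
    (hu'.intervalIntegrable _ _) hv'.intervalIntegrable
  rw [add_zero] at h
  rw [emIntegral, emIntegral]
  linear_combination h

theorem euler_maclaurin_unit {G : ℕ → ℝ → ℂ} {a : ℝ} (J : ℕ)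
    (hd : ∀ j ≤ J, ∀ x ∈ Set.Icc a (a + 1), HasDerivAt (G j) (G (j + 1) x) x)
    (hc : ContinuousOn (G (J + 1)) (Set.Icc a (a + 1))) :
    G 0 a = (∫ t in a..(a + 1), G 0 t) + (emBdry (J + 1) G (a + 1) - emBdry (J + 1) G a)
      + (-1) ^ J * emIntegral G a (J + 1) := by
  induction J with
  | zero =>
    have h := emIntegral_step (hd 0 le_rfl) hc
    have h0 : emIntegral G a 0 = ∫ t in a..(a + 1), G 0 t := by
      simp [emIntegral]
    rw [h0] at h
    simp only [zero_add, bernoulliFun_one] at h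
    simp only [emBdry, zero_add, Finset.sum_range_one, emCoeff_zero, pow_zero, one_mul]
    norm_num at h
    rw [h]
    ring
  | succ J ih =>
    have hcJ : ContinuousOn (G (J + 1)) (Set.Icc a (a + 1)) :=
      HasDerivAt.continuousOn (hd (J + 1) le_rfl)
    have h1 := ih (fun j hj => hd j (hj.trans J.le_succ)) hcJ
    have h2 := emIntegral_step (hd (J + 1) le_rfl) hc
    rw [bernoulliFun_endpoints_eq_of_ne_one (by omega), bernoulliFun_eval_zero] at h2
    -- The sign produced by repeated integration by parts is harmless: for odd J the Bernoulli
    -- coefficient is zero.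
    have h3 : (-1 : ℂ) ^ J * emCoeff (J + 1) = emCoeff (J + 1) := by
      rcases Nat.even_or_odd J with h | h
      · rw [h.neg_one_pow, one_mul]
      · rw [emCoeff_eq_zero h.add_one (by omega), mul_zero]
    have h4 : emCoeff (J + 1) =
        (((bernoulli (J + 1 + 1) : ℚ) : ℝ) : ℂ) / ((J + 1 + 1)! : ℂ) := by
      simp [emCoeff]
    rw [← h4] at h2
    have e1 : ∀ x, emBdry (J + 1 + 1) G x = emBdry (J + 1) G x + emCoeff (J + 1) * G (J + 1) x :=
      fun x => Finset.sum_range_succ _ _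
    rw [h2] at h1
    rw [e1, e1, h1, pow_succ]
    linear_combination (G (J + 1) (a + 1) - G (J + 1) a) * h3

theorem exists_emIntegral_bound (j : ℕ) : ∃ K : ℝ, 0 ≤ K ∧ ∀ (G : ℕ → ℝ → ℂ) (a B : ℝ),
    (∀ x ∈ Set.Icc a (a + 1), ‖G j x‖ ≤ B) → ‖emIntegral G a j‖ ≤ K * B := by
  have hcont : Continuous fun t : ℝ => ‖(bernoulliFun j t : ℂ) / (j ! : ℂ)‖ := by fun_prop
  obtain ⟨K, hK⟩ := (isCompact_Icc (a := (0 : ℝ)) (b := 1)).bddAbove_image hcont.continuousOn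
  have hK' : ∀ t ∈ Set.Icc (0 : ℝ) 1, ‖(bernoulliFun j t : ℂ) / (j ! : ℂ)‖ ≤ K :=
    fun t ht => hK ⟨t, ht, rfl⟩
  have hK0 : 0 ≤ K := (norm_nonneg _).trans (hK' 0 (by simp))
  refine ⟨K, hK0, fun G a B hB => ?_⟩
  have h := intervalIntegral.norm_integral_le_of_norm_le_const (a := (0 : ℝ)) (b := 1)
    (C := K * B) (f := fun t => ((bernoulliFun j t : ℂ) / (j ! : ℂ)) * G j (a + t)) ?_
  · simpa [emIntegral] using h
  · intro t ht
    rw [Set.uIoc_of_le zero_le_one] at ht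
    rw [norm_mul]
    exact mul_le_mul (hK' t ⟨ht.1.le, ht.2⟩)
      (hB _ ⟨by linarith [ht.1], by linarith [ht.2]⟩) (norm_nonneg _) hK0

/-- The constant depends on J alone, so the estimate can be summed over all unit intervals and over
all N. -/
theorem exists_euler_maclaurin_unit_bound (J : ℕ) : ∃ K : ℝ, 0 ≤ K ∧
    ∀ (G : ℕ → ℝ → ℂ) (a B : ℝ),
    (∀ j ≤ J + 1, ∀ x ∈ Set.Icc a (a + 1), HasDerivAt (G j) (G (j + 1) x) x) →
    (∀ x ∈ Set.Icc a (a + 1), ‖G (J + 1) x‖ ≤ B) →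
    ‖G 0 a - (∫ t in a..(a + 1), G 0 t)
      - (emBdry (J + 1) G (a + 1) - emBdry (J + 1) G a)‖ ≤ K * B := by
  obtain ⟨K, hK0, hK⟩ := exists_emIntegral_bound (J + 1)
  refine ⟨K, hK0, fun G a B hd hB => ?_⟩
  have h := euler_maclaurin_unit J (fun j hj => hd j (hj.trans J.le_succ))
    (HasDerivAt.continuousOn (hd (J + 1) le_rfl))
  have h2 : G 0 a - (∫ t in a..(a + 1), G 0 t)
      - (emBdry (J + 1) G (a + 1) - emBdry (J + 1) G a) = (-1) ^ J * emIntegral G a (J + 1) := by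
    linear_combination h
  rw [h2, norm_mul, norm_pow, norm_neg, norm_one, one_pow, one_mul]
  exact hK G a B hB

theorem exists_euler_maclaurin_bound {H : ℕ → ℝ → ℂ} (J : ℕ)
    (hd : ∀ j, ∀ x ∈ Set.Icc (0 : ℝ) 1, HasDerivAt (H j) (H (j + 1) x) x) :
    ∃ C : ℝ, ∀ N : ℕ, 1 ≤ N →
      ‖∑ k ∈ Finset.range N, H 0 ((k : ℝ) / N) - N * (∫ x in (0 : ℝ)..1, H 0 x)
        - ∑ j ∈ Finset.range (J + 1), emCoeff j * ((N : ℂ) ^ j)⁻¹ * (H j 1 - H j 0)‖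
      ≤ C * ((N : ℝ) ^ J)⁻¹ := by
  obtain ⟨K, hK0, hK⟩ := exists_euler_maclaurin_unit_bound J
  have hcont : ∀ j, ContinuousOn (H j) (Set.Icc 0 1) := fun j => HasDerivAt.continuousOn (hd j)
  obtain ⟨B, hB⟩ := isCompact_Icc.bddAbove_image (hcont (J + 1)).norm
  have hB' : ∀ t ∈ Set.Icc (0 : ℝ) 1, ‖H (J + 1) t‖ ≤ B := fun t ht => hB ⟨t, ht, rfl⟩
  refine ⟨K * B, fun N hN => ?_⟩
  have hN0 : (0 : ℝ) < N := by exact_mod_cast hN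
  have hNc : (N : ℂ) ≠ 0 := by exact_mod_cast hN0.ne'
  -- Rescaling to unit step costs N^(-j) on the j-th derivative. Each of the N intervals then has
  -- error of order N^(-(J+1)), and boundary terms telescope.
  set G : ℕ → ℝ → ℂ := fun j y => ((N : ℂ) ^ j)⁻¹ * H j (y / N) with hG
  have hmem : ∀ k ∈ Finset.range N, ∀ x ∈ Set.Icc (k : ℝ) (k + 1),
      x / N ∈ Set.Icc (0 : ℝ) 1 := by
    intro k hk x hx
    have hk' : (k : ℝ) + 1 ≤ N := by exact_mod_cast Finset.mem_range.1 hk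
    have hk0 : (0 : ℝ) ≤ k := k.cast_nonneg
    exact ⟨div_nonneg (hk0.trans hx.1) hN0.le, (div_le_one hN0).2 (hx.2.trans hk')⟩
  have hGd : ∀ k ∈ Finset.range N, ∀ j, ∀ x ∈ Set.Icc (k : ℝ) (k + 1),
      HasDerivAt (G j) (G (j + 1) x) x := by
    intro k hk j x hx
    have h1 := hd j (x / N) (hmem k hk x hx)
    have h2 : HasDerivAt (fun y : ℝ => y / N) (1 / N) x := (hasDerivAt_id' x).div_const _
    have h3 := (h1.scomp x h2).const_mul (((N : ℂ) ^ j)⁻¹)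
    refine h3.congr_deriv ?_
    simp only [hG, Complex.real_smul, pow_succ]
    push_cast
    field_simp
  have hunit : ∀ k ∈ Finset.range N, ‖G 0 k - (∫ t in (k : ℝ)..(k + 1), G 0 t)
      - (emBdry (J + 1) G (k + 1) - emBdry (J + 1) G k)‖ ≤ K * (((N : ℝ) ^ (J + 1))⁻¹ * B) := by
    intro k hk
    refine hK G k _ (fun j _ => hGd k hk j) fun x hx => ?_
    simp only [hG]
    rw [norm_mul, norm_inv, norm_pow, Complex.norm_natCast]
    exact mul_le_mul_of_nonneg_left (hB' _ (hmem k hk x hx)) (by positivity)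
  have hsum := norm_sum_le_of_le _ hunit
  rw [Finset.sum_const, Finset.card_range, Finset.sum_sub_distrib, Finset.sum_sub_distrib] at hsum
  have hint : ∑ k ∈ Finset.range N, (∫ t in (k : ℝ)..(k + 1), G 0 t) =
      N * (∫ x in (0 : ℝ)..1, H 0 x) := by
    have h1 := intervalIntegral.sum_integral_adjacent_intervals (f := G 0) (n := N)
      (a := fun k : ℕ => (k : ℝ)) (μ := MeasureTheory.volume) ?_
    · push_cast at h1
      rw [h1]
      simp only [hG, pow_zero, inv_one, one_mul]
      rw [intervalIntegral.integral_comp_div _ hN0.ne', zero_div, div_self hN0.ne',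
        Complex.real_smul]
      simp
    · intro k hk
      push_cast
      refine ContinuousOn.intervalIntegrable ?_
      rw [Set.uIcc_of_le (by linarith)]
      exact HasDerivAt.continuousOn (hGd k (Finset.mem_range.2 hk) 0)
  have htel : ∑ k ∈ Finset.range N, (emBdry (J + 1) G ((k : ℝ) + 1) - emBdry (J + 1) G k) =
      ∑ j ∈ Finset.range (J + 1), emCoeff j * ((N : ℂ) ^ j)⁻¹ * (H j 1 - H j 0) := by
    have h1 := Finset.sum_range_sub (fun k : ℕ => emBdry (J + 1) G (k : ℝ)) N
    push_cast at h1
    rw [h1, emBdry, emBdry, ← Finset.sum_sub_distrib]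
    refine Finset.sum_congr rfl fun j _ => ?_
    simp only [hG]
    rw [div_self hN0.ne', zero_div]
    ring
  rw [hint, htel] at hsum
  have h0 : ∑ k ∈ Finset.range N, G 0 (k : ℝ) = ∑ k ∈ Finset.range N, H 0 ((k : ℝ) / N) := by
    simp [hG]
  rw [h0] at hsum
  refine hsum.trans (le_of_eq ?_)
  rw [nsmul_eq_mul, pow_succ]
  field_simp

/-! ### Asymptotics of the power sums -/

/-- The `j`-th derivative of `x ^ e`. -/
def zpowDeriv (e : ℤ) (j : ℕ) (x : ℝ) : ℂ :=
  (∏ i ∈ Finset.range j, ((e : ℂ) - i)) * (x : ℂ) ^ (e - j)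

theorem zpowDeriv_zero (e : ℤ) (x : ℝ) : zpowDeriv e 0 x = (x : ℂ) ^ e := by
  simp [zpowDeriv]

theorem zpowDeriv_eq_zero {m j : ℕ} (h : m < j) (x : ℝ) : zpowDeriv m j x = 0 := by
  rw [zpowDeriv, Finset.prod_eq_zero (Finset.mem_range.2 h) (by simp), zero_mul]

theorem hasDerivAt_zpowDeriv (e : ℤ) (j : ℕ) {x : ℝ} (hx : x ≠ 0 ∨ 0 ≤ e) :
    HasDerivAt (zpowDeriv e j) (zpowDeriv e (j + 1) x) x := by
  by_cases h : x ≠ 0 ∨ 0 ≤ e - j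
  · have h1 : HasDerivAt (fun z : ℂ => z ^ (e - j)) (((e - j : ℤ) : ℂ) * (x : ℂ) ^ (e - j - 1))
        (x : ℂ) := hasDerivAt_zpow _ _ (h.imp_left fun h => by exact_mod_cast h)
    refine ((h1.comp_ofReal).const_mul _).congr_deriv ?_
    rw [zpowDeriv, Finset.prod_range_succ]
    push_cast
    rw [sub_sub]
    ring
  -- Here x = 0 and 0 ≤ e < j: the falling factorial contains the factor 0, so the function is
  -- identically zero.
  · push Not at h
    have he : 0 ≤ e := hx.resolve_left (by simp [h.1])
    obtain ⟨m, rfl⟩ := Int.eq_ofNat_of_zero_le he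
    have hm : m < j := by omega
    have e1 : zpowDeriv m j = fun _ => 0 := funext (zpowDeriv_eq_zero hm)
    rw [zpowDeriv_eq_zero (hm.trans j.lt_succ_self)]
    change HasDerivAt (zpowDeriv m j) 0 x
    rw [e1]
    exact hasDerivAt_const _ _

theorem zpowDeriv_natCast (e : ℤ) (j : ℕ) {N : ℕ} (hN : 1 ≤ N) :
    zpowDeriv e j N = (N : ℂ) ^ e * (((N : ℂ) ^ j)⁻¹ * zpowDeriv e j 1) := by
  have hNc : (N : ℂ) ≠ 0 := by exact_mod_cast (by omega : N ≠ 0)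
  rw [zpowDeriv, zpowDeriv, Complex.ofReal_one, one_zpow, Complex.ofReal_natCast,
    zpow_sub₀ hNc, zpow_natCast]
  field_simp

/-- Bounds on increments become a rate of convergence by summing the tail up to the limit. -/
theorem norm_sub_le_of_tendsto {E : ℕ → ℂ} {l : ℂ} {C : ℝ} {q : ℕ} (hC : 0 ≤ C)
    (h : ∀ n : ℕ, 1 ≤ n → ‖E (n + 1) - E n‖ ≤ C * ((n : ℝ) ^ (q + 2))⁻¹)
    (hl : Tendsto E atTop (𝓝 l)) {N : ℕ} (hN : 1 ≤ N) :
    ‖E N - l‖ ≤ 2 * C * ((N : ℝ) ^ (q + 1))⁻¹ := by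
  have hN0 : (0 : ℝ) < N := by exact_mod_cast hN
  have key : ∀ n, N ≤ n → ‖E n - E N‖ ≤ 2 * C * ((N : ℝ) ^ q)⁻¹ * ((N : ℝ)⁻¹ - (n : ℝ)⁻¹) := by
    intro n hn
    induction n, hn using Nat.le_induction with
    | base => simp
    | succ n hn ih =>
      have hn1 : 1 ≤ n := hN.trans hn
      have hn0 : (1 : ℝ) ≤ n := by exact_mod_cast hn1
      have hNn : (N : ℝ) ≤ n := by exact_mod_cast hn
      have h1 := h n hn1
      -- As n + 1 ≤ 2n, one has 1/n² ≤ 2(1/n - 1/(n+1)), which telescopes; the other q powers are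
      -- bounded by their value at N.
      have h2 : ((n : ℝ) ^ (q + 2))⁻¹ ≤
          ((N : ℝ) ^ q)⁻¹ * (2 * ((n : ℝ)⁻¹ - ((n : ℝ) + 1)⁻¹)) := by
        rw [pow_add, mul_inv]
        refine mul_le_mul ?_ ?_ (by positivity) (by positivity)
        · exact inv_anti₀ (by positivity) (pow_le_pow_left₀ hN0.le hNn q)
        · have e : 2 * ((n : ℝ)⁻¹ - ((n : ℝ) + 1)⁻¹) = 2 / (n * (n + 1)) := by
            field_simp
            ring
          rw [e, ← one_div, div_le_div_iff₀ (by positivity) (by positivity)]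
          nlinarith
      have h3 : ‖E (n + 1) - E N‖ ≤ ‖E (n + 1) - E n‖ + ‖E n - E N‖ := by
        have := norm_add_le (E (n + 1) - E n) (E n - E N)
        simpa using this
      have h4 := mul_le_mul_of_nonneg_left h2 hC
      push_cast
      calc ‖E (n + 1) - E N‖ ≤ _ := h3
        _ ≤ C * (((N : ℝ) ^ q)⁻¹ * (2 * ((n : ℝ)⁻¹ - ((n : ℝ) + 1)⁻¹)))
            + 2 * C * ((N : ℝ) ^ q)⁻¹ * ((N : ℝ)⁻¹ - (n : ℝ)⁻¹) := add_le_add (h1.trans h4) ih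
        _ = _ := by ring
  have hlim : Tendsto (fun n => ‖E n - E N‖) atTop (𝓝 ‖l - E N‖) := (hl.sub_const _).norm
  rw [norm_sub_rev]
  refine le_of_tendsto hlim ?_
  filter_upwards [eventually_ge_atTop N] with n hn
  refine (key n hn).trans ?_
  have : (N : ℝ)⁻¹ - (n : ℝ)⁻¹ ≤ (N : ℝ)⁻¹ := by
    have : (0 : ℝ) ≤ (n : ℝ)⁻¹ := by positivity
    linarith
  calc _ ≤ 2 * C * ((N : ℝ) ^ q)⁻¹ * (N : ℝ)⁻¹ := mul_le_mul_of_nonneg_left this (by positivity)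
    _ = _ := by rw [pow_succ, mul_inv]; ring

/-- The error in the Euler-Maclaurin formula for `∑ k ^ e`, up to a constant. -/
def powSumError (e : ℤ) (Ψ : ℝ → ℂ) (J N : ℕ) : ℂ :=
  ∑ k ∈ Finset.Ico 1 N, (k : ℂ) ^ e - Ψ N - emBdry (J + 1) (zpowDeriv e) N

theorem powSumError_succ_sub {e : ℤ} {Ψ : ℝ → ℂ} {J N : ℕ} (hN : 1 ≤ N)
    (hΨ : ∀ x : ℝ, 1 ≤ x → HasDerivAt Ψ ((x : ℂ) ^ e) x) :
    powSumError e Ψ J (N + 1) - powSumError e Ψ J N =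
      zpowDeriv e 0 N - (∫ t in (N : ℝ)..(N + 1), zpowDeriv e 0 t)
        - (emBdry (J + 1) (zpowDeriv e) (N + 1) - emBdry (J + 1) (zpowDeriv e) N) := by
  have hN1 : (1 : ℝ) ≤ N := by exact_mod_cast hN
  have hint : ∫ t in (N : ℝ)..(N + 1), zpowDeriv e 0 t = Ψ (N + 1) - Ψ N := by
    refine intervalIntegral.integral_eq_sub_of_hasDerivAt (fun x hx => ?_) ?_
    · rw [Set.uIcc_of_le (by linarith)] at hx
      rw [zpowDeriv_zero]
      exact hΨ x (hN1.trans hx.1)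
    · refine ContinuousOn.intervalIntegrable fun x hx => ?_
      rw [Set.uIcc_of_le (by linarith)] at hx
      have hx0 : x ≠ 0 := (by linarith [hx.1] : (0 : ℝ) < x).ne'
      exact (hasDerivAt_zpowDeriv e 0 (Or.inl hx0)).continuousAt.continuousWithinAt
  rw [hint, powSumError, powSumError, Finset.sum_Ico_succ_top hN, zpowDeriv_zero]
  push_cast
  ring

theorem zpowDeriv_neg_eq (m j : ℕ) (x : ℝ) :
    zpowDeriv (-(m + 1 : ℕ)) j x =
      (∏ i ∈ Finset.range j, (((-(m + 1 : ℕ) : ℤ) : ℂ) - i)) * ((x : ℂ) ^ (m + 1 + j))⁻¹ := by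
  rw [zpowDeriv, show (-((m + 1 : ℕ) : ℤ) - (j : ℤ)) = -((m + 1 + j : ℕ) : ℤ) by push_cast; ring,
    zpow_neg, zpow_natCast]

theorem tendsto_emBdry_neg (m J : ℕ) :
    Tendsto (fun N : ℕ => emBdry J (zpowDeriv (-(m + 1 : ℕ))) N) atTop (𝓝 0) := by
  have h : ∀ j ∈ Finset.range J, Tendsto
      (fun N : ℕ => emCoeff j * zpowDeriv (-(m + 1 : ℕ)) j N) atTop (𝓝 0) := by
    intro j _
    have h1 := ((tendsto_inv_atTop_nhds_zero_nat (𝕜 := ℂ)).pow (m + 1 + j)).const_mul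
      (emCoeff j * ∏ i ∈ Finset.range j, (((-(m + 1 : ℕ) : ℤ) : ℂ) - i))
    rw [zero_pow (by omega), mul_zero] at h1
    refine h1.congr fun N => ?_
    rw [zpowDeriv_neg_eq, Complex.ofReal_natCast, inv_pow]
    ring
  simpa [emBdry] using tendsto_finsetSum _ h

/-- The increments are Euler–Maclaurin errors on unit intervals, of order n^(-(m+J+2)). The boundary
terms decay, so the limit is the constant l of the bare sum. -/
theorem exists_powSumError_bound_neg {m : ℕ} {Ψ : ℝ → ℂ} {l : ℂ} (J : ℕ)
    (hΨ : ∀ x : ℝ, 1 ≤ x → HasDerivAt Ψ ((x : ℂ) ^ (-(m + 1 : ℕ) : ℤ)) x)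
    (hl : Tendsto (fun N : ℕ => ∑ k ∈ Finset.Ico 1 N, (k : ℂ) ^ (-(m + 1 : ℕ) : ℤ) - Ψ N)
      atTop (𝓝 l)) :
    ∃ C : ℝ, ∀ N : ℕ, 1 ≤ N →
      ‖powSumError (-(m + 1 : ℕ)) Ψ J N - l‖ ≤ C * ((N : ℝ) ^ (m + J + 1))⁻¹ := by
  obtain ⟨K, hK0, hK⟩ := exists_euler_maclaurin_unit_bound J
  set c : ℝ := ‖∏ i ∈ Finset.range (J + 1), (((-(m + 1 : ℕ) : ℤ) : ℂ) - i)‖ with hc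
  have hlim : Tendsto (powSumError (-(m + 1 : ℕ)) Ψ J) atTop (𝓝 l) := by
    have := hl.sub (tendsto_emBdry_neg m (J + 1))
    rwa [sub_zero] at this
  refine ⟨2 * (K * c), fun N hN => norm_sub_le_of_tendsto (mul_nonneg hK0 (norm_nonneg _))
    (fun n hn => ?_) hlim hN⟩
  have hn1 : (1 : ℝ) ≤ n := by exact_mod_cast hn
  rw [powSumError_succ_sub hn hΨ, mul_assoc]
  refine hK _ _ _ (fun j _ x hx => hasDerivAt_zpowDeriv _ j
    (Or.inl (by linarith [hx.1] : (0 : ℝ) < x).ne')) fun x hx => ?_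
  have hx0 : (0 : ℝ) < x := by linarith [hx.1]
  rw [zpowDeriv_neg_eq, norm_mul, norm_inv, norm_pow, Complex.norm_real, Real.norm_eq_abs,
    abs_of_pos hx0]
  refine mul_le_mul_of_nonneg_left ?_ (norm_nonneg _)
  rw [show m + 1 + (J + 1) = m + J + 2 by ring]
  exact inv_anti₀ (by positivity) (pow_le_pow_left₀ (by linarith) hx.1 _)

/-- The asymptotic expansion of `∑ (k / N) ^ e` with constant `l` and antiderivative `Ψ`. -/
def HasPowSumExpansion (e : ℤ) (l : ℂ) (Ψ : ℝ → ℂ) (J : ℕ) : Prop :=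
  ∃ C : ℝ, ∀ N : ℕ, 1 ≤ N →
    ‖∑ k ∈ Finset.Ico 1 N, ((k : ℂ) / N) ^ e - (N : ℂ) ^ (-e) * (l + Ψ N)
      - ∑ j ∈ Finset.range (J + 1), emCoeff j * ((N : ℂ) ^ j)⁻¹ * zpowDeriv e j 1‖
    ≤ C * ((N : ℝ) ^ J)⁻¹

theorem powSum_scaled {e : ℤ} {l : ℂ} {Ψ : ℝ → ℂ} {J N : ℕ} (hN : 1 ≤ N) :
    ∑ k ∈ Finset.Ico 1 N, ((k : ℂ) / N) ^ e - (N : ℂ) ^ (-e) * (l + Ψ N)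
      - ∑ j ∈ Finset.range (J + 1), emCoeff j * ((N : ℂ) ^ j)⁻¹ * zpowDeriv e j 1 =
    (N : ℂ) ^ (-e) * (powSumError e Ψ J N - l) := by
  have hNc : (N : ℂ) ≠ 0 := by exact_mod_cast (by omega : N ≠ 0)
  have hz : (N : ℂ) ^ e ≠ 0 := zpow_ne_zero _ hNc
  rw [powSumError, emBdry]
  have h1 : ∑ k ∈ Finset.Ico 1 N, ((k : ℂ) / N) ^ e =
      (N : ℂ) ^ (-e) * ∑ k ∈ Finset.Ico 1 N, (k : ℂ) ^ e := by
    rw [Finset.mul_sum]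
    refine Finset.sum_congr rfl fun k _ => ?_
    rw [div_zpow, zpow_neg]
    field_simp
  have h2 : ∑ j ∈ Finset.range (J + 1), emCoeff j * ((N : ℂ) ^ j)⁻¹ * zpowDeriv e j 1 =
      (N : ℂ) ^ (-e) * ∑ j ∈ Finset.range (J + 1), emCoeff j * zpowDeriv e j N := by
    rw [Finset.mul_sum]
    refine Finset.sum_congr rfl fun j _ => ?_
    rw [zpowDeriv_natCast e j hN, zpow_neg]
    field_simp
  rw [h1, h2]
  ring

theorem hasPowSumExpansion_neg {m : ℕ} {Ψ : ℝ → ℂ} {l : ℂ} (J : ℕ)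
    (hΨ : ∀ x : ℝ, 1 ≤ x → HasDerivAt Ψ ((x : ℂ) ^ (-(m + 1 : ℕ) : ℤ)) x)
    (hl : Tendsto (fun N : ℕ => ∑ k ∈ Finset.Ico 1 N, (k : ℂ) ^ (-(m + 1 : ℕ) : ℤ) - Ψ N)
      atTop (𝓝 l)) :
    HasPowSumExpansion (-(m + 1 : ℕ)) l Ψ J := by
  obtain ⟨C, hC⟩ := exists_powSumError_bound_neg J hΨ hl
  refine ⟨C, fun N hN => ?_⟩
  have hN0 : (0 : ℝ) < N := by exact_mod_cast hN
  rw [powSum_scaled hN, norm_mul, neg_neg, zpow_natCast, norm_pow, Complex.norm_natCast]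
  refine (mul_le_mul_of_nonneg_left (hC N hN) (by positivity)).trans (le_of_eq ?_)
  rw [show m + J + 1 = (m + 1) + J by ring, pow_add (N : ℝ) (m + 1) J]
  field_simp

theorem hasPowSumExpansion_neg_one (J : ℕ) :
    HasPowSumExpansion (-1) Real.eulerMascheroniConstant (fun x => (Real.log x : ℂ)) J := by
  have h := hasPowSumExpansion_neg (m := 0) (Ψ := fun x => (Real.log x : ℂ))
    (l := Real.eulerMascheroniConstant) J ?_ ?_
  · simpa using h
  · intro x hx
    have := (Real.hasDerivAt_log (by linarith : x ≠ 0)).ofReal_comp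
    refine this.congr_deriv ?_
    simp
  · have h1 := (Complex.continuous_ofReal.tendsto _).comp Real.tendsto_harmonic_sub_log
    have h2 := h1.sub (tendsto_inv_atTop_nhds_zero_nat (𝕜 := ℂ))
    rw [sub_zero] at h2
    refine h2.congr' ?_
    filter_upwards [eventually_ge_atTop 1] with N hN
    simp only [Function.comp_apply, harmonic_eq_sum_Icc]
    have : ∑ k ∈ Finset.Icc 1 N, ((k : ℂ))⁻¹ = ∑ k ∈ Finset.Ico 1 N, ((k : ℂ))⁻¹ + (N : ℂ)⁻¹ := by
      rw [← Finset.sum_Ico_succ_top hN]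
      rfl
    push_cast
    rw [this]
    simp
    ring

theorem hasPowSumExpansion_neg_of_two_le {a : ℕ} (ha : 2 ≤ a) (J : ℕ) :
    HasPowSumExpansion (-(a : ℤ)) (riemannZeta a)
      (fun x => (x : ℂ) ^ (-(a : ℤ) + 1) / (-(a : ℂ) + 1)) J := by
  obtain ⟨m, rfl⟩ : ∃ m, a = m + 1 := ⟨a - 1, by omega⟩
  have hm : (-((m + 1 : ℕ) : ℂ) + 1) ≠ 0 := by
    push_cast
    simp
    omega
  refine hasPowSumExpansion_neg (m := m) J ?_ ?_
  · intro x hx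
    have h1 := (hasDerivAt_zpow (-((m + 1 : ℕ) : ℤ) + 1) (x : ℂ)
      (Or.inl (by exact_mod_cast (by linarith : x ≠ 0)))).comp_ofReal
    refine (h1.div_const _).congr_deriv ?_
    rw [add_sub_cancel_right]
    push_cast at hm ⊢
    field_simp
  · have h1 : HasSum (fun n : ℕ => (1 : ℂ) / (n : ℂ) ^ (m + 1)) (riemannZeta (m + 1 : ℕ)) := by
      rw [zeta_nat_eq_tsum_of_gt_one (by omega)]
      refine Summable.hasSum ?_
      have := Complex.summable_one_div_nat_cpow (p := ((m + 1 : ℕ) : ℂ))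
      simp only [Complex.cpow_natCast] at this
      refine this.2 ?_
      rw [Complex.natCast_re]
      exact_mod_cast (by omega : 1 < m + 1)
    have h2 := h1.tendsto_sum_nat
    have h3 : Tendsto (fun N : ℕ => ((N : ℝ) : ℂ) ^ (-((m + 1 : ℕ) : ℤ) + 1)
        / (-((m + 1 : ℕ) : ℂ) + 1)) atTop (𝓝 0) := by
      have h4 := ((tendsto_inv_atTop_nhds_zero_nat (𝕜 := ℂ)).pow m).div_const
        (-((m + 1 : ℕ) : ℂ) + 1)
      rw [zero_pow (by omega), zero_div] at h4
      refine h4.congr fun N => ?_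
      rw [show (-((m + 1 : ℕ) : ℤ) + 1) = -(m : ℤ) by push_cast; ring, zpow_neg, zpow_natCast,
        Complex.ofReal_natCast, inv_pow]
    have h5 := h2.sub h3
    rw [sub_zero] at h5
    refine h5.congr' ?_
    filter_upwards [eventually_ge_atTop 1] with N hN
    rw [Finset.range_eq_Ico, Finset.sum_eq_sum_Ico_succ_bot (by omega)]
    simp only [zpow_neg, zpow_natCast]
    simp

/-- For a polynomial the formula is exact (Faulhaber), so the error constant is 0. The constant term
is read off at the endpoint 0. -/
theorem hasPowSumExpansion_of_odd {m J : ℕ} (hm : Odd m) (hJ : m ≤ J) :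
    HasPowSumExpansion (m : ℤ) (riemannZeta (-(m : ℂ)))
      (fun x => (x : ℂ) ^ ((m : ℤ) + 1) / ((m : ℂ) + 1)) J := by
  have hm1 : (m : ℂ) + 1 ≠ 0 := by exact_mod_cast m.succ_ne_zero
  have hm0 : m ≠ 0 := hm.pos.ne'
  set Ψ : ℝ → ℂ := fun x => (x : ℂ) ^ ((m : ℤ) + 1) / ((m : ℂ) + 1) with hΨdef
  have hΨ : ∀ x : ℝ, HasDerivAt Ψ ((x : ℂ) ^ (m : ℤ)) x := by
    intro x
    have h1 := (hasDerivAt_zpow ((m : ℤ) + 1) (x : ℂ) (Or.inr (by omega))).comp_ofReal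
    refine (h1.div_const _).congr_deriv ?_
    rw [add_sub_cancel_right]
    push_cast
    field_simp
  obtain ⟨K, hK0, hK⟩ := exists_euler_maclaurin_unit_bound J
  -- The derivative of order J+1 > m vanishes, so the remainder bound is 0.
  have hstep : ∀ a : ℝ, zpowDeriv m 0 a - (Ψ (a + 1) - Ψ a)
        - (emBdry (J + 1) (zpowDeriv m) (a + 1) - emBdry (J + 1) (zpowDeriv m) a) = 0 := by
    intro a
    have h1 := hK (zpowDeriv m) a 0 (fun j _ x _ => hasDerivAt_zpowDeriv _ j (Or.inr (by omega)))
      (fun x _ => by rw [zpowDeriv_eq_zero (by omega), norm_zero])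
    have hint : ∫ t in a..(a + 1), zpowDeriv m 0 t = Ψ (a + 1) - Ψ a := by
      refine intervalIntegral.integral_eq_sub_of_hasDerivAt (fun x _ => ?_) ?_
      · rw [zpowDeriv_zero]
        exact hΨ x
      · refine Continuous.intervalIntegrable ?_ _ _
        exact continuous_iff_continuousAt.2 fun x =>
          (hasDerivAt_zpowDeriv m 0 (Or.inr (by omega))).continuousAt
    rw [hint, mul_zero] at h1
    exact norm_le_zero_iff.1 h1
  -- At 0 only the m-th derivative, equal to m!, survives. Its term is B_(m+1)/(m+1), which is
  -- -ζ(-m) for odd m.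
  have hbdry : emBdry (J + 1) (zpowDeriv m) 0 = -riemannZeta (-(m : ℂ)) := by
    rw [emBdry, Finset.sum_eq_single m]
    · have hprod : ∀ n : ℕ, ∏ i ∈ Finset.range n, (((n : ℕ) : ℂ) - i) = (n ! : ℂ) := by
        intro n
        rw [← Finset.prod_range_reflect, ← Finset.prod_range_add_one_eq_factorial, Nat.cast_prod]
        refine Finset.prod_congr rfl fun i hi => ?_
        have hi' := Finset.mem_range.1 hi
        rw [Nat.cast_sub (by omega), Nat.cast_sub (by omega)]
        push_cast
        ring
      rw [zpowDeriv, Int.cast_natCast, hprod, riemannZeta_neg_nat_eq_bernoulli, emCoeff,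
        Nat.factorial_succ, hm.neg_one_pow]
      have h1 : (m ! : ℂ) ≠ 0 := by exact_mod_cast m.factorial_ne_zero
      push_cast
      simp only [sub_self, zpow_zero]
      field_simp
    · intro j _ hjm
      rcases lt_or_gt_of_ne hjm with h | h
      · rw [zpowDeriv, Complex.ofReal_zero, zero_zpow _ (by omega)]
        simp
      · rw [zpowDeriv_eq_zero h, mul_zero]
    · intro h
      exact absurd (Finset.mem_range.2 (by omega)) h
  refine ⟨0, fun N hN => ?_⟩
  have hsum : ∀ n : ℕ, ∑ k ∈ Finset.range n, (k : ℂ) ^ (m : ℤ) =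
      Ψ n + emBdry (J + 1) (zpowDeriv m) n + riemannZeta (-(m : ℂ)) := by
    intro n
    induction n with
    | zero =>
      have hΨ0 : Ψ 0 = 0 := by
        simp only [hΨdef, Complex.ofReal_zero]
        rw [zero_zpow _ (by omega), zero_div]
      rw [Nat.cast_zero, hbdry, hΨ0]
      simp
    | succ n ih =>
      have h1 := hstep n
      rw [zpowDeriv_zero] at h1
      rw [Finset.sum_range_succ, ih]
      push_cast at h1 ⊢
      linear_combination h1
  have h2 : powSumError m Ψ J N - riemannZeta (-(m : ℂ)) = 0 := by
    have h3 := hsum N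
    rw [Finset.range_eq_Ico, Finset.sum_eq_sum_Ico_succ_bot (by omega), Nat.cast_zero,
      zero_zpow _ (by omega), zero_add, zero_add] at h3
    rw [powSumError, h3]
    ring
  rw [powSum_scaled hN, h2]
  simp

end

/-! ### Laurent expansion of the cosecant power and its regularization -/

section

open Topology Metric PowerSeries

/-- Each divided slope at 0 strips one Taylor term and stays holomorphic on the whole disc. -/
theorem exists_taylor_quotient (K : ℕ) {F : ℂ → ℂ} (hF : DifferentiableOn ℂ F (ball 0 1)) :
    ∃ E : ℂ → ℂ, DifferentiableOn ℂ E (ball 0 1) ∧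
      ∀ z, F z = ∑ k ∈ Finset.range K, coeff k (taylorPS F) * z ^ k + z ^ K * E z := by
  induction K generalizing F with
  | zero => exact ⟨F, hF, fun z => by simp⟩
  | succ K ih =>
    have hnhds : ball (0 : ℂ) 1 ∈ 𝓝 0 := ball_mem_nhds 0 one_pos
    have hD : DifferentiableOn ℂ (dslope F 0) (ball 0 1) :=
      (Complex.differentiableOn_dslope hnhds).2 hF
    obtain ⟨E, hE, hEq⟩ := ih hD
    have hF0 : ∀ z, F z = F 0 + z * dslope F 0 z := fun z => by
      have := sub_smul_dslope F 0 z
      rw [smul_eq_mul, sub_zero] at this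
      rw [this]
      ring
    have hDa : AnalyticAt ℂ (dslope F 0) 0 := hD.analyticAt hnhds
    have hT : taylorPS F = C (F 0) + X * taylorPS (dslope F 0) := by
      rw [← taylorPS_id, ← taylorPS_mul (f := fun z => z) analyticAt_id hDa, ← taylorPS_const,
        ← taylorPS_add analyticAt_const (AnalyticAt.fun_mul (f := fun z => z) analyticAt_id hDa)]
      exact taylorPS_congr (Eventually.of_forall hF0)
    refine ⟨E, hE, fun z => ?_⟩
    have hc : ∀ k, coeff (k + 1) (taylorPS F) = coeff k (taylorPS (dslope F 0)) := by
      intro k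
      rw [hT, map_add, coeff_succ_X_mul, coeff_C, if_neg (by omega), zero_add]
    have hc0 : coeff 0 (taylorPS F) = F 0 := by
      simp [coeff_taylorPS]
    rw [Finset.sum_range_succ', hF0 z, hEq z, hc0, mul_add, Finset.mul_sum]
    simp only [hc, pow_succ]
    have : ∀ k, z * (coeff k (taylorPS (dslope F 0)) * z ^ k) =
        coeff k (taylorPS (dslope F 0)) * (z ^ k * z) := fun k => by ring
    simp only [this]
    ring

/-- The function `1 / sin (π z) ^ (2 M + 1)`. -/
def cscPow (M : ℕ) (z : ℂ) : ℂ := (Complex.sin (Real.pi * z) ^ (2 * M + 1))⁻¹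

/-- The Laurent coefficients of `cscPow M` at `0`. -/
def cscCoeff (M n : ℕ) : ℂ := sincAlpha n (2 * M + 1) / (Real.pi : ℂ) ^ (2 * M + 1)

/-- The Laurent exponents of `cscPow M` at `0`. -/
def cscExp (M n : ℕ) : ℤ := 2 * n - (2 * M + 1)

theorem cscPow_one_sub (M : ℕ) (z : ℂ) : cscPow M (1 - z) = cscPow M z := by
  rw [cscPow, cscPow, mul_sub, mul_one, Complex.sin_pi_sub]

theorem exists_cscPow_expansion (M q : ℕ) : ∃ E : ℂ → ℂ, DifferentiableOn ℂ E (ball 0 1) ∧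
    ∀ z ∈ ball (0 : ℂ) 1, z ≠ 0 →
      cscPow M z = ∑ n ∈ Finset.range (M + q + 1), cscCoeff M n * z ^ cscExp M n
        + z ^ (2 * q + 1) * E z := by
  have hpi : (Real.pi : ℂ) ≠ 0 := by exact_mod_cast Real.pi_ne_zero
  set F : ℂ → ℂ := fun z => (normSinc z ^ (2 * M + 1))⁻¹ with hFdef
  have hF : DifferentiableOn ℂ F (ball 0 1) := by
    intro z hz
    refine DifferentiableAt.differentiableWithinAt ?_
    exact ((differentiable_normSinc z).pow _).inv
      (pow_ne_zero _ (normSinc_ne_zero (by simpa using hz)))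
  -- The integer power is holomorphic on the whole disc without any choice of logarithm; agreement
  -- near 0 suffices to identify the coefficients.
  have hT : taylorPS F = taylorPS (sincPow (2 * M + 1)) := by
    refine taylorPS_congr ?_
    filter_upwards [normSinc_ne_zero_eventually] with z hz
    have := sincPow_natCast (2 * M + 1) hz
    push_cast at this
    rw [this]
  obtain ⟨E, hE, hEq⟩ := exists_taylor_quotient (2 * (M + q + 1)) hF
  have hsum : ∀ (n : ℕ) (z : ℂ), ∑ k ∈ Finset.range (2 * n), coeff k (taylorPS F) * z ^ k =
      ∑ k ∈ Finset.range n, sincAlpha k (2 * M + 1) * z ^ (2 * k) := by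
    intro n z
    induction n with
    | zero => simp
    | succ n ih =>
      rw [show 2 * (n + 1) = 2 * n + 1 + 1 by ring, Finset.sum_range_succ, Finset.sum_range_succ,
        ih, Finset.sum_range_succ, hT, coeff_taylorPS_even, coeff_taylorPS_odd]
      ring
  refine ⟨fun z => ((Real.pi : ℂ) ^ (2 * M + 1))⁻¹ * E z, hE.const_mul _, fun z _ hz0 => ?_⟩
  have h1 : cscPow M z = ((Real.pi : ℂ) ^ (2 * M + 1))⁻¹ * (z ^ (2 * M + 1))⁻¹ * F z := by
    rw [cscPow, ← pi_mul_normSinc, hFdef, mul_pow, mul_pow, mul_inv, mul_inv]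
  rw [h1, hEq z, hsum, mul_add, Finset.mul_sum]
  congr 1
  · refine Finset.sum_congr rfl fun n _ => ?_
    rw [cscCoeff, cscExp, zpow_sub₀ hz0,
      show (2 * (n : ℤ)) = ((2 * n : ℕ) : ℤ) by push_cast; ring,
      show (2 * (M : ℤ) + 1) = ((2 * M + 1 : ℕ) : ℤ) by push_cast; ring, zpow_natCast,
      zpow_natCast]
    field_simp
  · rw [show 2 * (M + q + 1) = (2 * M + 1) + (2 * q + 1) by ring, pow_add z (2 * M + 1)]
    field_simp

theorem iteratedDeriv_pow_mul_zero {r j : ℕ} (hj : j < r) {E : ℂ → ℂ} (hE : AnalyticAt ℂ E 0) :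
    iteratedDeriv j (fun z => z ^ r * E z) 0 = 0 := by
  have hid : AnalyticAt ℂ (fun z : ℂ => z ^ r) 0 := by fun_prop
  rw [show (fun z => z ^ r * E z) = (fun z => z ^ r) * E from rfl,
    iteratedDeriv_mul hid.contDiffAt hE.contDiffAt]
  refine Finset.sum_eq_zero fun i hi => ?_
  have hi' := Finset.mem_range.1 hi
  rw [iteratedDeriv_fun_pow_zero, if_neg (by omega)]
  simp

theorem iteratedDeriv_one_sub_zpow_zero (e : ℤ) (j : ℕ) :
    iteratedDeriv j (fun z : ℂ => (1 - z) ^ e) 0 = (-1) ^ j * zpowDeriv e j 1 := by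
  have h := congrFun (iteratedDeriv_comp_const_sub j (fun z : ℂ => z ^ e) 1) 0
  rw [h, sub_zero, smul_eq_mul, iteratedDeriv_eq_iterate, iter_deriv_zpow]
  simp [zpowDeriv]

/-- A function `u` minus the singular part at `1` of `cscPow M`. -/
def regPart (M n : ℕ) (u : ℂ → ℂ) (z : ℂ) : ℂ :=
  u z - ∑ k ∈ Finset.range n, cscCoeff M k * (1 - z) ^ cscExp M k

theorem one_sub_ne_zero_of_mem_ball {z : ℂ} (hz : z ∈ ball (0 : ℂ) 1) : 1 - z ≠ 0 := by
  intro h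
  rw [← sub_eq_zero.1 h] at hz
  simp at hz

theorem differentiableOn_regPart (M n : ℕ) {u : ℂ → ℂ} (hu : DifferentiableOn ℂ u (ball 0 1)) :
    DifferentiableOn ℂ (regPart M n u) (ball 0 1) := by
  refine hu.sub (DifferentiableOn.fun_sum fun k _ => ?_)
  refine DifferentiableOn.const_mul (fun z hz => ?_) _
  exact (DifferentiableAt.zpow (by fun_prop)
    (Or.inl (one_sub_ne_zero_of_mem_ball hz))).differentiableWithinAt

/-- The remainder z^r E has a zero of order at least r, so below that order only the powers of 1-z
contribute. -/
theorem iteratedDeriv_regPart_zero {M n r j : ℕ} (hj : j < r) {E : ℂ → ℂ}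
    (hE : AnalyticAt ℂ E 0) :
    iteratedDeriv j (regPart M n fun z => z ^ r * E z) 0 =
      -((-1) ^ j * ∑ k ∈ Finset.range n, cscCoeff M k * zpowDeriv (cscExp M k) j 1) := by
  have hu : AnalyticAt ℂ (fun z : ℂ => z ^ r * E z) 0 := by fun_prop
  have hz : ∀ k, AnalyticAt ℂ (fun z : ℂ => (1 - z) ^ cscExp M k) 0 := fun k =>
    AnalyticAt.fun_zpow (by fun_prop) (by simp)
  have hv : ∀ k ∈ Finset.range n,
      ContDiffAt ℂ j (fun z : ℂ => cscCoeff M k * (1 - z) ^ cscExp M k) 0 := fun k _ =>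
    (analyticAt_const.fun_mul (hz k)).contDiffAt
  have e : (regPart M n fun z => z ^ r * E z) = (fun z : ℂ => z ^ r * E z)
      - fun z => ∑ k ∈ Finset.range n, cscCoeff M k * (1 - z) ^ cscExp M k := rfl
  rw [e, iteratedDeriv_sub hu.contDiffAt (ContDiffAt.sum hv), iteratedDeriv_pow_mul_zero hj hE,
    iteratedDeriv_fun_sum hv, zero_sub, Finset.mul_sum]
  congr 1
  refine Finset.sum_congr rfl fun k _ => ?_
  rw [iteratedDeriv_const_mul_field, iteratedDeriv_one_sub_zpow_zero]
  ring

/-- Gluing of a function near `0` with its reflection near `1`. -/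
def reflectGlue (A : ℂ → ℂ) (z : ℂ) : ℂ := if z.re < 1 / 2 then A z else A (1 - z)

theorem norm_one_sub_le {z : ℂ} (h : 1 / 2 ≤ z.re) : ‖1 - z‖ ≤ ‖z‖ := by
  rw [← abs_of_nonneg (norm_nonneg (1 - z)), ← abs_of_nonneg (norm_nonneg z), ← sq_le_sq,
    Complex.sq_norm, Complex.sq_norm, Complex.normSq_apply, Complex.normSq_apply]
  simp
  nlinarith

theorem reflectGlue_eq {A : ℂ → ℂ}
    (hA : ∀ z ∈ ball (0 : ℂ) 1, 1 - z ∈ ball (0 : ℂ) 1 → A (1 - z) = A z) {z : ℂ}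
    (hz : z ∈ ball (0 : ℂ) 1) : reflectGlue A z = A z := by
  rw [reflectGlue]
  split_ifs with h
  · rfl
  · refine hA z hz ?_
    rw [mem_ball_zero_iff] at hz ⊢
    exact (norm_one_sub_le (not_lt.1 h)).trans_lt hz

theorem reflectGlue_one_sub {A : ℂ → ℂ}
    (hA : ∀ z ∈ ball (0 : ℂ) 1, 1 - z ∈ ball (0 : ℂ) 1 → A (1 - z) = A z) {z : ℂ}
    (hz : z ∈ ball (0 : ℂ) 1) : reflectGlue A (1 - z) = A z := by
  rw [reflectGlue]
  split_ifs with h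
  · refine hA z hz ?_
    have h1 : 1 / 2 ≤ z.re := by
      simp at h
      linarith
    rw [mem_ball_zero_iff] at hz ⊢
    exact (norm_one_sub_le h1).trans_lt hz
  · rw [sub_sub_cancel]

theorem reflectGlue_eventuallyEq_zero {A : ℂ → ℂ}
    (hA : ∀ z ∈ ball (0 : ℂ) 1, 1 - z ∈ ball (0 : ℂ) 1 → A (1 - z) = A z) {z : ℂ}
    (hz : z ∈ ball (0 : ℂ) 1) : reflectGlue A =ᶠ[𝓝 z] A := by
  filter_upwards [isOpen_ball.mem_nhds hz] with w hw
  exact reflectGlue_eq hA hw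

theorem reflectGlue_eventuallyEq_one {A : ℂ → ℂ}
    (hA : ∀ z ∈ ball (0 : ℂ) 1, 1 - z ∈ ball (0 : ℂ) 1 → A (1 - z) = A z) {z : ℂ}
    (hz : 1 - z ∈ ball (0 : ℂ) 1) : reflectGlue A =ᶠ[𝓝 z] fun w => A (1 - w) := by
  have hc : Continuous fun w : ℂ => 1 - w := by fun_prop
  filter_upwards [(isOpen_ball.preimage hc).mem_nhds hz] with w hw
  have := reflectGlue_one_sub hA hw
  rwa [sub_sub_cancel] at this

/-- The disc around 0 misses the endpoint 1. Gluing with the reflection supplies the analytic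
extension there. -/
theorem analyticAt_reflectGlue {A : ℂ → ℂ} (hd : DifferentiableOn ℂ A (ball 0 1))
    (hA : ∀ z ∈ ball (0 : ℂ) 1, 1 - z ∈ ball (0 : ℂ) 1 → A (1 - z) = A z) {x : ℝ}
    (hx : x ∈ Set.Icc (0 : ℝ) 1) : AnalyticAt ℂ (reflectGlue A) x := by
  rcases hx.2.lt_or_eq with h | h
  · have hz : (x : ℂ) ∈ ball (0 : ℂ) 1 := by
      rw [mem_ball_zero_iff, Complex.norm_real, Real.norm_eq_abs, abs_of_nonneg hx.1]
      exact h
    exact (hd.analyticAt (isOpen_ball.mem_nhds hz)).congr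
      (reflectGlue_eventuallyEq_zero hA hz).symm
  · have hz : 1 - (x : ℂ) ∈ ball (0 : ℂ) 1 := by
      rw [h]
      simp
    refine AnalyticAt.congr ?_ (reflectGlue_eventuallyEq_one hA hz).symm
    have h1 : AnalyticAt ℂ A (1 - (x : ℂ)) := hd.analyticAt (isOpen_ball.mem_nhds hz)
    exact AnalyticAt.fun_comp h1 (by fun_prop)

theorem iteratedDeriv_reflectGlue_zero {A : ℂ → ℂ}
    (hA : ∀ z ∈ ball (0 : ℂ) 1, 1 - z ∈ ball (0 : ℂ) 1 → A (1 - z) = A z) (j : ℕ) :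
    iteratedDeriv j (reflectGlue A) 0 = iteratedDeriv j A 0 :=
  (reflectGlue_eventuallyEq_zero hA (by simp)).iteratedDeriv_eq j

theorem iteratedDeriv_reflectGlue_one {A : ℂ → ℂ}
    (hA : ∀ z ∈ ball (0 : ℂ) 1, 1 - z ∈ ball (0 : ℂ) 1 → A (1 - z) = A z) (j : ℕ) :
    iteratedDeriv j (reflectGlue A) 1 = (-1) ^ j * iteratedDeriv j A 0 := by
  rw [(reflectGlue_eventuallyEq_one hA (z := 1) (by simp)).iteratedDeriv_eq j,
    congrFun (iteratedDeriv_comp_const_sub j A 1) 1, sub_self, smul_eq_mul]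

theorem hasDerivAt_iteratedDeriv_ofReal {h : ℂ → ℂ} {x : ℝ} (hx : AnalyticAt ℂ h x) (j : ℕ) :
    HasDerivAt (fun t : ℝ => iteratedDeriv j h (t : ℂ)) (iteratedDeriv (j + 1) h (x : ℂ)) x := by
  have h1 : AnalyticAt ℂ (iteratedDeriv j h) (x : ℂ) := by
    rw [iteratedDeriv_eq_iterate]
    exact hx.iterated_deriv j
  have h2 := h1.differentiableAt.hasDerivAt.comp_ofReal
  rwa [← iteratedDeriv_succ] at h2

end

/-! ### Asymptotics of the cosecant sum -/

section

open Topology Metric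

/-- The sum of the singular parts of `cscPow M` at `0` and at `1`. -/
def singPart (M n : ℕ) (z : ℂ) : ℂ :=
  ∑ k ∈ Finset.range n, cscCoeff M k * (z ^ cscExp M k + (1 - z) ^ cscExp M k)

theorem regPart_eq_sub_singPart {M n r : ℕ} {E : ℂ → ℂ} {z : ℂ}
    (hE : cscPow M z = ∑ k ∈ Finset.range n, cscCoeff M k * z ^ cscExp M k + z ^ r * E z) :
    regPart M n (fun z => z ^ r * E z) z = cscPow M z - singPart M n z := by
  simp only [regPart, singPart, hE, mul_add, Finset.sum_add_distrib]
  ring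

theorem singPart_one_sub (M n : ℕ) (z : ℂ) : singPart M n (1 - z) = singPart M n z := by
  simp only [singPart, sub_sub_cancel]
  exact Finset.sum_congr rfl fun k _ => by rw [add_comm]

theorem regPart_one_sub {M n r : ℕ} {E : ℂ → ℂ}
    (hE : ∀ z ∈ ball (0 : ℂ) 1, z ≠ 0 →
      cscPow M z = ∑ k ∈ Finset.range n, cscCoeff M k * z ^ cscExp M k + z ^ r * E z) :
    ∀ z ∈ ball (0 : ℂ) 1, 1 - z ∈ ball (0 : ℂ) 1 →
      regPart M n (fun z => z ^ r * E z) (1 - z) = regPart M n (fun z => z ^ r * E z) z := by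
  intro z hz hz1
  have h0 : z ≠ 0 := by
    rintro rfl
    simp at hz1
  rw [regPart_eq_sub_singPart (hE _ hz1 (one_sub_ne_zero_of_mem_ball hz)),
    regPart_eq_sub_singPart (hE _ hz h0), cscPow_one_sub, singPart_one_sub]

theorem reflectGlue_regPart_eq {M n r : ℕ} {E : ℂ → ℂ}
    (hE : ∀ z ∈ ball (0 : ℂ) 1, z ≠ 0 →
      cscPow M z = ∑ k ∈ Finset.range n, cscCoeff M k * z ^ cscExp M k + z ^ r * E z)
    {x : ℝ} (hx : x ∈ Set.Ioo (0 : ℝ) 1) :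
    reflectGlue (regPart M n fun z => z ^ r * E z) x = cscPow M x - singPart M n x := by
  have hz : (x : ℂ) ∈ ball (0 : ℂ) 1 := by
    rw [mem_ball_zero_iff, Complex.norm_real, Real.norm_eq_abs, abs_of_pos hx.1]
    exact hx.2
  have h0 : (x : ℂ) ≠ 0 := by exact_mod_cast hx.1.ne'
  rw [reflectGlue_eq (regPart_one_sub hE) hz, regPart_eq_sub_singPart (hE _ hz h0)]

theorem natCast_div_mem_Ioo {k N : ℕ} (hk : k ∈ Finset.Ico 1 N) :
    ((k : ℝ) / N) ∈ Set.Ioo (0 : ℝ) 1 := by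
  have h := Finset.mem_Ico.1 hk
  have h1 : (0 : ℝ) < k := by exact_mod_cast h.1
  have h2 : (k : ℝ) < N := by exact_mod_cast h.2
  exact ⟨div_pos h1 (h1.trans h2), (div_lt_one (h1.trans h2)).2 h2⟩

/-- The substitution k ↦ N-k exchanges the two ends, which therefore contribute equally. -/
theorem sum_singPart (M n : ℕ) {N : ℕ} :
    ∑ k ∈ Finset.Ico 1 N, singPart M n ((k : ℂ) / N) =
      2 * ∑ i ∈ Finset.range n,
        cscCoeff M i * ∑ k ∈ Finset.Ico 1 N, ((k : ℂ) / N) ^ cscExp M i := by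
  simp only [singPart]
  rw [Finset.sum_comm, Finset.mul_sum]
  refine Finset.sum_congr rfl fun i _ => ?_
  have h : ∑ k ∈ Finset.Ico 1 N, (1 - (k : ℂ) / N) ^ cscExp M i =
      ∑ k ∈ Finset.Ico 1 N, ((k : ℂ) / N) ^ cscExp M i := by
    refine Finset.sum_nbij' (fun k => N - k) (fun k => N - k) ?_ ?_ ?_ ?_ ?_
    · intro k hk
      rw [Finset.mem_Ico] at hk ⊢
      omega
    · intro k hk
      rw [Finset.mem_Ico] at hk ⊢
      omega
    · intro k hk
      rw [Finset.mem_Ico] at hk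
      omega
    · intro k hk
      rw [Finset.mem_Ico] at hk
      omega
    · intro k hk
      rw [Finset.mem_Ico] at hk
      have hN : (N : ℂ) ≠ 0 := by exact_mod_cast (by omega : N ≠ 0)
      rw [Nat.cast_sub hk.2.le, sub_div, div_self hN]
  rw [← Finset.mul_sum, Finset.sum_add_distrib, h]
  ring

theorem sum_bdry_cancel {q : ℕ} {D : ℕ → ℂ} (h0 : ∀ j < 2 * q + 1, Odd j → D j = 0) (N : ℕ) :
    ∑ j ∈ Finset.range (2 * q + 1 + 1), emCoeff j * ((N : ℂ) ^ j)⁻¹ * D j =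
      emCoeff 0 * D 0 + emCoeff (2 * q + 1) * ((N : ℂ) ^ (2 * q + 1))⁻¹ * D (2 * q + 1) := by
  rw [Finset.sum_range_succ, Finset.sum_range_succ']
  congr 1
  rw [Finset.sum_eq_zero, zero_add]
  · simp
  · intro j hj
    have hj' := Finset.mem_range.1 hj
    rcases Nat.even_or_odd (j + 1) with h | h
    · rw [emCoeff_eq_zero h (by omega)]
      simp
    · rw [h0 (j + 1) (by omega) h, mul_zero]

theorem exists_cscPow_sum_bound {M q : ℕ} {E : ℂ → ℂ} {l : ℕ → ℂ} {Ψ : ℕ → ℝ → ℂ}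
    (hEd : DifferentiableOn ℂ E (ball 0 1))
    (hE : ∀ z ∈ ball (0 : ℂ) 1, z ≠ 0 →
      cscPow M z = ∑ k ∈ Finset.range (M + q + 1), cscCoeff M k * z ^ cscExp M k
        + z ^ (2 * q + 1) * E z)
    (hP : ∀ n < M + q + 1, HasPowSumExpansion (cscExp M n) (l n) (Ψ n) (2 * q + 1)) :
    ∃ C : ℝ, ∀ N : ℕ, 1 ≤ N →
      ‖∑ k ∈ Finset.Ico 1 N, cscPow M ((k : ℂ) / N)
        - N * (∫ x in (0 : ℝ)..1,
          reflectGlue (regPart M (M + q + 1) fun z => z ^ (2 * q + 1) * E z) x)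
        - 2 * ∑ n ∈ Finset.range (M + q + 1),
          cscCoeff M n * ((N : ℂ) ^ (-cscExp M n) * (l n + Ψ n N))‖
      ≤ C * ((N : ℝ) ^ (2 * q + 1))⁻¹ := by
  set r := 2 * q + 1 with hr
  set A : ℂ → ℂ := regPart M (M + q + 1) fun z => z ^ r * E z with hA
  set h : ℂ → ℂ := reflectGlue A with hh
  set H : ℕ → ℝ → ℂ := fun j t => iteratedDeriv j h (t : ℂ) with hH
  have hAsym := regPart_one_sub hE
  have hE0 : AnalyticAt ℂ E 0 := hEd.analyticAt (ball_mem_nhds 0 one_pos)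
  have hAd : DifferentiableOn ℂ A (ball 0 1) :=
    differentiableOn_regPart M _ (DifferentiableOn.fun_mul (by fun_prop) hEd)
  have hd : ∀ j, ∀ x ∈ Set.Icc (0 : ℝ) 1, HasDerivAt (H j) (H (j + 1) x) x := fun j x hx =>
    hasDerivAt_iteratedDeriv_ofReal (analyticAt_reflectGlue hAd hAsym hx) j
  obtain ⟨C1, hC1⟩ := exists_euler_maclaurin_bound r hd
  choose! C2 hC2 using hP
  -- The total boundary contribution of order j: from the regularized function, and from the power
  -- sums of both ends.
  set D : ℕ → ℂ := fun j => H j 1 - H j 0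
    + 2 * ∑ n ∈ Finset.range (M + q + 1), cscCoeff M n * zpowDeriv (cscExp M n) j 1 with hD
  have hH0 : ∀ j < r, H j 0 =
      -((-1) ^ j * ∑ k ∈ Finset.range (M + q + 1),
        cscCoeff M k * zpowDeriv (cscExp M k) j 1) := by
    intro j hj
    simp only [hH, hh, Complex.ofReal_zero]
    rw [iteratedDeriv_reflectGlue_zero hAsym, iteratedDeriv_regPart_zero hj hE0]
  have hH1 : ∀ j, H j 1 = (-1) ^ j * H j 0 := by
    intro j
    simp only [hH, hh, Complex.ofReal_zero, Complex.ofReal_one]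
    rw [iteratedDeriv_reflectGlue_zero hAsym, iteratedDeriv_reflectGlue_one hAsym]
  -- For odd j the reflection gives H_j(1) = -H_j(0), and the resulting jump exactly cancels the
  -- power-sum terms.
  have hDodd : ∀ j < r, Odd j → D j = 0 := by
    intro j hj hodd
    simp only [hD]
    rw [hH1, hH0 j hj, hodd.neg_one_pow]
    ring
  -- The order-zero boundary term accounts for k = 0, present in the Euler–Maclaurin sum but absent
  -- from the cosecant sum.
  have hD0 : emCoeff 0 * D 0 - H 0 0 = 0 := by
    simp only [hD]
    rw [hH1, hH0 0 (by omega), emCoeff_zero, pow_zero]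
    ring
  refine ⟨C1 + ‖emCoeff r * D r‖
    + 2 * ∑ n ∈ Finset.range (M + q + 1), ‖cscCoeff M n‖ * C2 n, fun N hN => ?_⟩
  have hNr : (0 : ℝ) < (N : ℝ) ^ r := pow_pos (by exact_mod_cast hN) r
  have e1 : ∑ k ∈ Finset.Ico 1 N, cscPow M ((k : ℂ) / N) =
      ∑ k ∈ Finset.range N, H 0 ((k : ℝ) / N) - H 0 0
        + ∑ k ∈ Finset.Ico 1 N, singPart M (M + q + 1) ((k : ℂ) / N) := by
    rw [Finset.sum_range_eq_add_Ico _ (by omega), Nat.cast_zero, zero_div,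
      add_sub_cancel_left, ← Finset.sum_add_distrib]
    refine Finset.sum_congr rfl fun k hk => ?_
    have := reflectGlue_regPart_eq hE (natCast_div_mem_Ioo hk)
    simp only [hH, iteratedDeriv_zero]
    rw [hh, hA, this]
    push_cast
    ring
  have hb1 := hC1 N hN
  have hb2 : ‖2 * ∑ n ∈ Finset.range (M + q + 1), cscCoeff M n *
      (∑ k ∈ Finset.Ico 1 N, ((k : ℂ) / N) ^ cscExp M n
        - (N : ℂ) ^ (-cscExp M n) * (l n + Ψ n N)
        - ∑ j ∈ Finset.range (r + 1),
          emCoeff j * ((N : ℂ) ^ j)⁻¹ * zpowDeriv (cscExp M n) j 1)‖ ≤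
      2 * ∑ n ∈ Finset.range (M + q + 1), ‖cscCoeff M n‖ * C2 n * ((N : ℝ) ^ r)⁻¹ := by
    rw [norm_mul, Complex.norm_ofNat]
    refine mul_le_mul_of_nonneg_left (norm_sum_le_of_le _ fun n hn => ?_) (by norm_num)
    rw [norm_mul, mul_assoc]
    exact mul_le_mul_of_nonneg_left (hC2 n (Finset.mem_range.1 hn) N hN) (norm_nonneg _)
  have hb3 : ‖emCoeff r * ((N : ℂ) ^ r)⁻¹ * D r‖ = ‖emCoeff r * D r‖ * ((N : ℝ) ^ r)⁻¹ := by
    rw [mul_right_comm, norm_mul _ (((N : ℂ) ^ r)⁻¹), norm_inv, norm_pow, Complex.norm_natCast]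
  have e2 := sum_bdry_cancel hDodd N
  have e3 : ∑ j ∈ Finset.range (r + 1), emCoeff j * ((N : ℂ) ^ j)⁻¹ * D j =
      ∑ j ∈ Finset.range (r + 1), emCoeff j * ((N : ℂ) ^ j)⁻¹ * (H j 1 - H j 0)
      + 2 * ∑ n ∈ Finset.range (M + q + 1), cscCoeff M n *
        ∑ j ∈ Finset.range (r + 1), emCoeff j * ((N : ℂ) ^ j)⁻¹ * zpowDeriv (cscExp M n) j 1 := by
    have : ∑ n ∈ Finset.range (M + q + 1), cscCoeff M n *
        ∑ j ∈ Finset.range (r + 1), emCoeff j * ((N : ℂ) ^ j)⁻¹ * zpowDeriv (cscExp M n) j 1 =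
        ∑ j ∈ Finset.range (r + 1), emCoeff j * ((N : ℂ) ^ j)⁻¹ *
          ∑ n ∈ Finset.range (M + q + 1), cscCoeff M n * zpowDeriv (cscExp M n) j 1 := by
      simp only [Finset.mul_sum]
      rw [Finset.sum_comm]
      exact Finset.sum_congr rfl fun j _ => Finset.sum_congr rfl fun n _ => by ring
    rw [this, Finset.mul_sum, ← Finset.sum_add_distrib]
    refine Finset.sum_congr rfl fun j _ => ?_
    simp only [hD]
    ring
  have eint : (∫ x in (0 : ℝ)..1, H 0 x) = ∫ x in (0 : ℝ)..1, h x := by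
    simp [hH]
  rw [eint] at hb1
  have key : ∑ k ∈ Finset.Ico 1 N, cscPow M ((k : ℂ) / N) - N * (∫ x in (0 : ℝ)..1, h x)
        - 2 * ∑ n ∈ Finset.range (M + q + 1),
          cscCoeff M n * ((N : ℂ) ^ (-cscExp M n) * (l n + Ψ n N)) =
      (∑ k ∈ Finset.range N, H 0 ((k : ℝ) / N) - N * (∫ x in (0 : ℝ)..1, h x)
        - ∑ j ∈ Finset.range (r + 1), emCoeff j * ((N : ℂ) ^ j)⁻¹ * (H j 1 - H j 0))
      + emCoeff r * ((N : ℂ) ^ r)⁻¹ * D r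
      + 2 * ∑ n ∈ Finset.range (M + q + 1), cscCoeff M n *
      (∑ k ∈ Finset.Ico 1 N, ((k : ℂ) / N) ^ cscExp M n
        - (N : ℂ) ^ (-cscExp M n) * (l n + Ψ n N)
        - ∑ j ∈ Finset.range (r + 1),
          emCoeff j * ((N : ℂ) ^ j)⁻¹ * zpowDeriv (cscExp M n) j 1) := by
    rw [e1, sum_singPart]
    simp only [mul_sub, Finset.sum_sub_distrib]
    simp only [mul_sub, Finset.sum_sub_distrib] at e3
    linear_combination hD0 + e2 - e3
  rw [key]
  refine (norm_add₃_le).trans ?_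
  rw [hb3]
  refine (add_le_add (add_le_add hb1 le_rfl) hb2).trans (le_of_eq ?_)
  rw [← Finset.sum_mul]
  ring

end

/-! ### Antiderivatives of odd cosecant powers and their constant terms -/

section

open Topology Metric

/-- An antiderivative of `1 / sin (π x) ^ (2 M + 1)` on `(0, 1)`, odd with respect to `1 / 2`. -/
def cscPrimitive : ℕ → ℝ → ℝ
  | 0, x => Real.log (Real.tan (Real.pi * x / 2)) / Real.pi
  | M + 1, x =>
    (-((2 * M + 1) * Real.pi * Real.cos (Real.pi * x) / Real.sin (Real.pi * x) ^ (2 * M + 2))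
      + (2 * M + 1) ^ 2 * Real.pi ^ 2 * cscPrimitive M x)
      / (Real.pi ^ 2 * (2 * M + 1) * (2 * M + 2))

theorem cscPrimitive_one_sub (M : ℕ) (x : ℝ) : cscPrimitive M (1 - x) = -cscPrimitive M x := by
  induction M with
  | zero =>
    rw [cscPrimitive, cscPrimitive, show Real.pi * (1 - x) / 2 = Real.pi / 2 - Real.pi * x / 2 by
      ring, Real.tan_pi_div_two_sub, Real.log_inv, neg_div]
  | succ M ih =>
    rw [cscPrimitive, cscPrimitive, ih, mul_sub, mul_one, Real.cos_pi_sub, Real.sin_pi_sub]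
    ring

theorem sin_pi_mul_pos {x : ℝ} (hx : x ∈ Set.Ioo (0 : ℝ) 1) : 0 < Real.sin (Real.pi * x) :=
  Real.sin_pos_of_pos_of_lt_pi (mul_pos Real.pi_pos hx.1)
    (by nlinarith [Real.pi_pos, hx.2])

theorem hasDerivAt_cscPow_real_deriv (M : ℕ) {x : ℝ} (hx : x ∈ Set.Ioo (0 : ℝ) 1) :
    HasDerivAt (fun x => -((2 * M + 1) * Real.pi * Real.cos (Real.pi * x)
        / Real.sin (Real.pi * x) ^ (2 * M + 2)))
      ((2 * M + 1) * Real.pi ^ 2 * ((2 * M + 2) - (2 * M + 1) * Real.sin (Real.pi * x) ^ 2)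
        / Real.sin (Real.pi * x) ^ (2 * M + 3)) x := by
  have hs := (sin_pi_mul_pos hx).ne'
  have hp : HasDerivAt (fun x => Real.pi * x) Real.pi x := by
    simpa using (hasDerivAt_id' x).const_mul Real.pi
  have h := (((hp.cos.const_mul ((2 * M + 1) * Real.pi)).fun_div (hp.sin.fun_pow (2 * M + 2))
    (pow_ne_zero _ hs)).fun_neg)
  refine h.congr_deriv ?_
  have hc : Real.cos (Real.pi * x) ^ 2 = 1 - Real.sin (Real.pi * x) ^ 2 := Real.cos_sq' _
  rw [show 2 * M + 2 - 1 = 2 * M + 1 by omega]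
  push_cast
  field_simp
  ring_nf
  rw [hc]
  ring

/-- Solving the second-order identity for csc^(2M+3) and integrating gives the reduction formula
behind the recursive definition. -/
theorem hasDerivAt_cscPrimitive (M : ℕ) {x : ℝ} (hx : x ∈ Set.Ioo (0 : ℝ) 1) :
    HasDerivAt (cscPrimitive M) ((Real.sin (Real.pi * x) ^ (2 * M + 1))⁻¹) x := by
  have hs := (sin_pi_mul_pos hx).ne'
  have hpi := Real.pi_ne_zero
  induction M with
  | zero =>
    have hp : HasDerivAt (fun x => Real.pi * x / 2) (Real.pi / 2) x := by
      simpa using ((hasDerivAt_id' x).const_mul Real.pi).div_const 2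
    have hdouble : Real.sin (Real.pi * x) =
        2 * Real.sin (Real.pi * x / 2) * Real.cos (Real.pi * x / 2) := by
      rw [← Real.sin_two_mul]
      ring_nf
    have hsh : Real.sin (Real.pi * x / 2) ≠ 0 := fun h => hs (by rw [hdouble, h]; ring)
    have hch : Real.cos (Real.pi * x / 2) ≠ 0 := fun h => hs (by rw [hdouble, h]; ring)
    have ht : Real.tan (Real.pi * x / 2) ≠ 0 := by
      rw [Real.tan_eq_sin_div_cos]
      exact div_ne_zero hsh hch
    have hcomp : HasDerivAt (fun x => Real.tan (Real.pi * x / 2))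
        (1 / Real.cos (Real.pi * x / 2) ^ 2 * (Real.pi / 2)) x :=
      HasDerivAt.comp (h₂ := Real.tan) x (Real.hasDerivAt_tan hch) hp
    refine ((hcomp.log ht).div_const Real.pi).congr_deriv ?_
    rw [Real.tan_eq_sin_div_cos, mul_zero, zero_add, pow_one, hdouble]
    field_simp
  | succ M ih =>
    have h := ((hasDerivAt_cscPow_real_deriv M hx).fun_add
      (ih.const_mul ((2 * M + 1) ^ 2 * Real.pi ^ 2))).div_const
      (Real.pi ^ 2 * (2 * M + 1) * (2 * M + 2))
    refine h.congr_deriv ?_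
    rw [show 2 * (M + 1) + 1 = 2 * M + 3 by ring]
    have h1 : (2 * (M : ℝ) + 1) ≠ 0 := by positivity
    have h2 : (2 * (M : ℝ) + 2) ≠ 0 := by positivity
    field_simp
    ring

/-- The constant term of `cscPrimitive M` at `0`. -/
def cscConst : ℕ → ℂ
  | 0 => (Real.log (Real.pi / 2) / Real.pi : ℝ)
  | M + 1 => (cscCoeff M (M + 1) + (2 * M + 1) ^ 2 * Real.pi ^ 2 * cscConst M)
      / (Real.pi ^ 2 * (2 * M + 1) * (2 * M + 2))

theorem cscCoeff_succ_succ (M n : ℕ) :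
    (Real.pi : ℂ) ^ 2 * (2 * M + 1) * (2 * M + 2) * cscCoeff (M + 1) (n + 1) =
      (cscExp M (n + 1) : ℂ) * ((cscExp M (n + 1) : ℂ) - 1) * cscCoeff M (n + 1)
        + (2 * M + 1) ^ 2 * (Real.pi : ℂ) ^ 2 * cscCoeff M n := by
  have hpi : (Real.pi : ℂ) ≠ 0 := by exact_mod_cast Real.pi_ne_zero
  have h := sincAlpha_recurrence n (2 * M + 1)
  have e : 2 * ((M + 1 : ℕ) : ℂ) + 1 = 2 * M + 1 + 2 := by push_cast; ring
  rw [cscCoeff, cscCoeff, cscCoeff, cscExp, e, show 2 * (M + 1) + 1 = (2 * M + 1) + 2 by ring,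
    pow_add]
  push_cast
  field_simp
  linear_combination h

theorem cscCoeff_succ_zero (M : ℕ) :
    (Real.pi : ℂ) ^ 2 * (2 * M + 1) * (2 * M + 2) * cscCoeff (M + 1) 0 =
      (cscExp M 0 : ℂ) * ((cscExp M 0 : ℂ) - 1) * cscCoeff M 0 := by
  have hpi : (Real.pi : ℂ) ≠ 0 := by exact_mod_cast Real.pi_ne_zero
  rw [cscCoeff, cscCoeff, cscExp, sincAlpha_zero_left, sincAlpha_zero_left,
    show 2 * (M + 1) + 1 = (2 * M + 1) + 2 by ring, pow_add]
  push_cast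
  field_simp
  ring

theorem cscExp_succ (M n : ℕ) : cscExp (M + 1) (n + 1) = cscExp M n := by
  rw [cscExp, cscExp]
  push_cast
  ring

theorem cscExp_succ_left (M n : ℕ) : cscExp (M + 1) n = cscExp M n - 2 := by
  rw [cscExp, cscExp]
  push_cast
  ring

theorem cscExp_succ_right (M n : ℕ) : cscExp M (n + 1) = cscExp M n + 2 := by
  rw [cscExp, cscExp]
  push_cast
  ring

theorem cscExp_add_one_ne_zero {M n : ℕ} (h : n ≠ M) : (cscExp M n : ℂ) + 1 ≠ 0 := by
  rw [cscExp]
  have : (2 * (n : ℤ) - (2 * M + 1)) + 1 ≠ 0 := by omega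
  exact_mod_cast this

/-- The differentiated Laurent series has as constant term the coefficient of x, which is what the
reduction formula adds to the finite part. -/
theorem tendsto_deriv_cscPow_sub (M : ℕ) :
    Tendsto (fun x : ℝ => ((-((2 * M + 1) * Real.pi * Real.cos (Real.pi * x)
        / Real.sin (Real.pi * x) ^ (2 * M + 2)) : ℝ) : ℂ)
      - ∑ n ∈ Finset.range (M + 1),
        cscCoeff M n * (cscExp M n * (x : ℂ) ^ (cscExp M n - 1))) (𝓝[>] 0)
      (𝓝 (cscCoeff M (M + 1))) := by
  -- With q = 1 the expansion includes the linear term n = M+1, and the remainder z³E has zero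
  -- derivative at 0.
  obtain ⟨E, hEd, hE⟩ := exists_cscPow_expansion M 1
  have hE0 : AnalyticAt ℂ E 0 := hEd.analyticAt (ball_mem_nhds 0 one_pos)
  have hu : AnalyticAt ℂ (fun z : ℂ => z ^ 3 * E z) 0 := by fun_prop
  have hu0 : deriv (fun z : ℂ => z ^ 3 * E z) 0 = 0 := by
    have := iteratedDeriv_pow_mul_zero (r := 3) (j := 1) (by norm_num) hE0
    rwa [iteratedDeriv_one] at this
  have hlim : Tendsto (fun x : ℝ => cscCoeff M (M + 1)
      + deriv (fun z : ℂ => z ^ 3 * E z) (x : ℂ)) (𝓝[>] 0) (𝓝 (cscCoeff M (M + 1))) := by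
    have h1 : Tendsto (deriv fun z : ℂ => z ^ 3 * E z) (𝓝 0) (𝓝 0) := by
      have := hu.deriv.continuousAt.tendsto
      rwa [hu0] at this
    have h2 : Tendsto (fun x : ℝ => (x : ℂ)) (𝓝[>] 0) (𝓝 0) := by
      have := (Complex.continuous_ofReal.tendsto 0).mono_left (nhdsWithin_le_nhds (s := Set.Ioi 0))
      simpa using this
    simpa using tendsto_const_nhds.add (h1.comp h2)
  refine hlim.congr' ?_
  filter_upwards [Ioo_mem_nhdsGT one_pos] with x hx
  have hxb : (x : ℂ) ∈ ball (0 : ℂ) 1 := by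
    rw [mem_ball_zero_iff, Complex.norm_real, Real.norm_eq_abs, abs_of_pos hx.1]
    exact hx.2
  have hx0 : (x : ℂ) ≠ 0 := by exact_mod_cast hx.1.ne'
  have hs : Complex.sin (Real.pi * x) ≠ 0 := by
    have := (sin_pi_mul_pos hx).ne'
    exact_mod_cast this
  have hp : HasDerivAt (fun z : ℂ => Real.pi * z) Real.pi (x : ℂ) := by
    simpa using (hasDerivAt_id' (x : ℂ)).const_mul (Real.pi : ℂ)
  have hL := (hp.csin.fun_pow (2 * M + 1)).fun_inv (pow_ne_zero _ hs)
  have hud : DifferentiableAt ℂ (fun z : ℂ => z ^ 3 * E z) (x : ℂ) :=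
    DifferentiableAt.fun_mul (by fun_prop) (hEd.differentiableAt (isOpen_ball.mem_nhds hxb))
  have hR : HasDerivAt (fun z : ℂ => ∑ n ∈ Finset.range (M + 1 + 1),
      cscCoeff M n * z ^ cscExp M n + z ^ 3 * E z)
      (∑ n ∈ Finset.range (M + 1 + 1),
        cscCoeff M n * (cscExp M n * (x : ℂ) ^ (cscExp M n - 1))
        + deriv (fun z : ℂ => z ^ 3 * E z) (x : ℂ)) (x : ℂ) :=
    (HasDerivAt.fun_sum fun n _ => (hasDerivAt_zpow _ _ (Or.inl hx0)).const_mul _).fun_add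
      hud.hasDerivAt
  have heq : (fun z => (Complex.sin (Real.pi * z) ^ (2 * M + 1))⁻¹) =ᶠ[𝓝 (x : ℂ)]
      fun z : ℂ => ∑ n ∈ Finset.range (M + 1 + 1), cscCoeff M n * z ^ cscExp M n + z ^ 3 * E z := by
    filter_upwards [isOpen_ball.mem_nhds hxb, isOpen_ne.mem_nhds hx0] with z hz hz0
    exact hE z hz hz0
  have huniq := hL.unique (hR.congr_of_eventuallyEq heq)
  rw [Finset.sum_range_succ] at huniq
  have he : cscExp M (M + 1) = 1 := by
    rw [cscExp]
    push_cast
    ring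
  have hlast : cscCoeff M (M + 1) * (cscExp M (M + 1) * (x : ℂ) ^ (cscExp M (M + 1) - 1)) =
      cscCoeff M (M + 1) := by
    rw [he]
    simp
  rw [hlast] at huniq
  have hreal : ((-((2 * M + 1) * Real.pi * Real.cos (Real.pi * x)
        / Real.sin (Real.pi * x) ^ (2 * M + 2)) : ℝ) : ℂ) =
      -(((2 * M + 1 : ℕ) : ℂ) * Complex.sin (Real.pi * x) ^ (2 * M + 1 - 1)
        * (Complex.cos (Real.pi * x) * Real.pi))
        / (Complex.sin (Real.pi * x) ^ (2 * M + 1)) ^ 2 := by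
    rw [Nat.add_sub_cancel]
    push_cast
    rw [← pow_mul, show (2 * M + 1) * 2 = 2 * M + (2 * M + 2) by ring, pow_add]
    field_simp
    ring
  rw [hreal, huniq]
  ring

/-- This identifies the recursively defined constant as the finite part at 0. In the induction,
polar and logarithmic terms match through the coefficient recurrence. -/
theorem tendsto_cscPrimitive_sub (M : ℕ) :
    Tendsto (fun x : ℝ => (cscPrimitive M x : ℂ)
      - ∑ n ∈ Finset.range M,
        cscCoeff M n * ((x : ℂ) ^ (cscExp M n + 1) / ((cscExp M n : ℂ) + 1))
      - cscCoeff M M * (Real.log x : ℂ)) (𝓝[>] 0) (𝓝 (cscConst M)) := by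
  induction M with
  | zero =>
    have hA : cscCoeff 0 0 = ((1 / Real.pi : ℝ) : ℂ) := by
      rw [cscCoeff, sincAlpha_zero_left]
      simp
    have h1 : Tendsto (fun x : ℝ => Real.tan (Real.pi * x / 2) / x) (𝓝[>] 0)
        (𝓝 (Real.pi / 2)) := by
      have hd : HasDerivAt (fun x : ℝ => Real.tan (Real.pi * x / 2)) (Real.pi / 2) 0 := by
        have hp : HasDerivAt (fun x => Real.pi * x / 2) (Real.pi / 2) 0 := by
          simpa using ((hasDerivAt_id' (0 : ℝ)).const_mul Real.pi).div_const 2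
        have h0 : Real.cos (Real.pi * 0 / 2) ≠ 0 := by simp
        have : HasDerivAt (fun x : ℝ => Real.tan (Real.pi * x / 2))
            (1 / Real.cos (Real.pi * 0 / 2) ^ 2 * (Real.pi / 2)) 0 :=
          HasDerivAt.comp (h₂ := Real.tan) 0 (Real.hasDerivAt_tan h0) hp
        simpa using this
      have := (hasDerivAt_iff_tendsto_slope.1 hd).mono_left
        (nhdsWithin_mono _ (fun x hx => (Set.mem_Ioi.1 hx).ne') : 𝓝[>] (0 : ℝ) ≤ 𝓝[≠] 0)
      refine this.congr fun x => ?_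
      simp [slope_def_field]
    have h2 : Tendsto (fun x : ℝ => Real.log (Real.tan (Real.pi * x / 2) / x) / Real.pi) (𝓝[>] 0)
        (𝓝 (Real.log (Real.pi / 2) / Real.pi)) :=
      (h1.log (by positivity)).div_const _
    have h3 := (Complex.continuous_ofReal.tendsto _).comp h2
    refine h3.congr' ?_
    filter_upwards [Ioo_mem_nhdsGT one_pos] with x hx
    have ht : 0 < Real.tan (Real.pi * x / 2) :=
      Real.tan_pos_of_pos_of_lt_pi_div_two (by have := Real.pi_pos; have := hx.1; positivity)
        (by nlinarith [Real.pi_pos, hx.2])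
    simp only [Function.comp_apply, Finset.range_zero, Finset.sum_empty, sub_zero, hA,
      cscPrimitive]
    rw [Real.log_div ht.ne' hx.1.ne', ← Complex.ofReal_mul, ← Complex.ofReal_sub]
    congr 1
    ring
  | succ M ih =>
    have hpi : (Real.pi : ℂ) ≠ 0 := by exact_mod_cast Real.pi_ne_zero
    have h1 : (2 * (M : ℂ) + 1) ≠ 0 := by exact_mod_cast (2 * M).succ_ne_zero
    have h2 : (2 * (M : ℂ) + 2) ≠ 0 := by exact_mod_cast (2 * M + 1).succ_ne_zero
    have hlim := ((tendsto_deriv_cscPow_sub M).add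
      (ih.const_mul ((2 * (M : ℂ) + 1) ^ 2 * Real.pi ^ 2))).div_const
      (Real.pi ^ 2 * (2 * M + 1) * (2 * M + 2) : ℂ)
    rw [cscConst]
    refine hlim.congr' ?_
    filter_upwards [self_mem_nhdsWithin] with x hx
    have hQ : (Real.pi ^ 2 * (2 * M + 1) * (2 * M + 2) : ℂ) ≠ 0 :=
      mul_ne_zero (mul_ne_zero (pow_ne_zero 2 hpi) h1) h2
    rw [div_eq_iff hQ]
    have hlog : (Real.pi ^ 2 * (2 * M + 1) * (2 * M + 2) : ℂ) * cscCoeff (M + 1) (M + 1) =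
        (2 * M + 1) ^ 2 * (Real.pi : ℂ) ^ 2 * cscCoeff M M := by
      rw [cscCoeff_succ_succ]
      have : cscExp M (M + 1) = 1 := by
        rw [cscExp]
        push_cast
        ring
      rw [this]
      simp
    have hfirst : ∀ (c e : ℂ) (k : ℤ), (e : ℂ) - 1 ≠ 0 →
        e * (e - 1) * c * ((x : ℂ) ^ k / (e - 1)) = c * (e * (x : ℂ) ^ k) := by
      intro c e k he
      field_simp
    have hne : ∀ n ≤ M, (cscExp M n : ℂ) - 1 ≠ 0 := by
      intro n hn
      rw [cscExp]
      have : (2 * (n : ℤ) - (2 * M + 1)) - 1 ≠ 0 := by omega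
      exact_mod_cast this
    have hsum : (Real.pi ^ 2 * (2 * M + 1) * (2 * M + 2) : ℂ) *
        ∑ n ∈ Finset.range (M + 1), cscCoeff (M + 1) n *
          ((x : ℂ) ^ (cscExp (M + 1) n + 1) / ((cscExp (M + 1) n : ℂ) + 1)) =
        ∑ n ∈ Finset.range (M + 1),
          cscCoeff M n * (cscExp M n * (x : ℂ) ^ (cscExp M n - 1))
        + (2 * M + 1) ^ 2 * Real.pi ^ 2 * ∑ n ∈ Finset.range M,
          cscCoeff M n * ((x : ℂ) ^ (cscExp M n + 1) / ((cscExp M n : ℂ) + 1)) := by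
      rw [Finset.mul_sum, Finset.sum_range_succ', Finset.sum_range_succ' _ M, Finset.mul_sum,
        add_right_comm, ← Finset.sum_add_distrib]
      congr 1
      · refine Finset.sum_congr rfl fun n hn => ?_
        have hn' := Finset.mem_range.1 hn
        rw [← mul_assoc, cscCoeff_succ_succ, add_mul, cscExp_succ]
        congr 1
        · have e1 : cscExp M n = cscExp M (n + 1) - 2 := by rw [cscExp_succ_right]; ring
          rw [e1, show cscExp M (n + 1) - 2 + 1 = cscExp M (n + 1) - 1 by ring]
          push_cast
          rw [show (cscExp M (n + 1) : ℂ) - 2 + 1 = cscExp M (n + 1) - 1 by ring]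
          exact hfirst _ _ _ (hne _ hn')
        · ring
      · rw [← mul_assoc, cscCoeff_succ_zero, cscExp_succ_left,
          show cscExp M 0 - 2 + 1 = cscExp M 0 - 1 by ring]
        push_cast
        rw [show (cscExp M 0 : ℂ) - 2 + 1 = cscExp M 0 - 1 by ring]
        exact hfirst _ _ _ (hne _ (Nat.zero_le _))
    have hprim : (Real.pi ^ 2 * (2 * M + 1) * (2 * M + 2) : ℂ) * (cscPrimitive (M + 1) x : ℂ) =
        ((-((2 * M + 1) * Real.pi * Real.cos (Real.pi * x)
        / Real.sin (Real.pi * x) ^ (2 * M + 2)) : ℝ) : ℂ)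
        + (2 * M + 1) ^ 2 * Real.pi ^ 2 * cscPrimitive M x := by
      rw [cscPrimitive, Complex.ofReal_div, Complex.ofReal_add]
      push_cast
      field_simp
    linear_combination hsum + (Real.log x : ℂ) * hlog - hprim

end

/-! ### The regularized integral and the constant G_M -/

section

open Topology Metric

/-- An antiderivative of `cscPow M - singPart M n`. -/
def regPrimitive (M n : ℕ) (x : ℝ) : ℂ :=
  (cscPrimitive M x : ℂ)
    - ∑ k ∈ (Finset.range n).erase M,
      cscCoeff M k * ((x : ℂ) ^ (cscExp M k + 1) / ((cscExp M k : ℂ) + 1)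
        - (1 - (x : ℂ)) ^ (cscExp M k + 1) / ((cscExp M k : ℂ) + 1))
    - cscCoeff M M * ((Real.log x : ℂ) - (Real.log (1 - x) : ℂ))

theorem regPrimitive_one_sub (M n : ℕ) (x : ℝ) :
    regPrimitive M n (1 - x) = -regPrimitive M n x := by
  have h : ∀ k, cscCoeff M k * ((1 - (x : ℂ)) ^ (cscExp M k + 1) / ((cscExp M k : ℂ) + 1)
        - (x : ℂ) ^ (cscExp M k + 1) / ((cscExp M k : ℂ) + 1)) =
      -(cscCoeff M k * ((x : ℂ) ^ (cscExp M k + 1) / ((cscExp M k : ℂ) + 1)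
        - (1 - (x : ℂ)) ^ (cscExp M k + 1) / ((cscExp M k : ℂ) + 1))) := fun k => by ring
  rw [regPrimitive, regPrimitive, cscPrimitive_one_sub]
  push_cast
  simp only [sub_sub_cancel, h, Finset.sum_neg_distrib]
  ring

theorem cscExp_self (M : ℕ) : cscExp M M = -1 := by
  rw [cscExp]
  ring

theorem hasDerivAt_regPrimitive {M n : ℕ} (hn : M < n) {x : ℝ} (hx : x ∈ Set.Ioo (0 : ℝ) 1) :
    HasDerivAt (regPrimitive M n) (cscPow M x - singPart M n x) x := by
  have hx0 : (x : ℂ) ≠ 0 := by exact_mod_cast hx.1.ne'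
  have hx1 : (1 : ℂ) - x ≠ 0 := by
    have : 1 - x ≠ 0 := (sub_pos.2 hx.2).ne'
    exact_mod_cast this
  have h1 := (hasDerivAt_cscPrimitive M hx).ofReal_comp
  have h2 : ∀ k ∈ (Finset.range n).erase M, HasDerivAt (fun x : ℝ =>
      cscCoeff M k * ((x : ℂ) ^ (cscExp M k + 1) / ((cscExp M k : ℂ) + 1)
        - (1 - (x : ℂ)) ^ (cscExp M k + 1) / ((cscExp M k : ℂ) + 1)))
      (cscCoeff M k * ((x : ℂ) ^ cscExp M k + (1 - (x : ℂ)) ^ cscExp M k)) x := by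
    intro k hk
    have hne := cscExp_add_one_ne_zero (Finset.ne_of_mem_erase hk)
    have e1 : HasDerivAt (fun z : ℂ => z ^ (cscExp M k + 1)) _ (x : ℂ) :=
      hasDerivAt_zpow _ _ (Or.inl hx0)
    have e2 : HasDerivAt (fun z : ℂ => z ^ (cscExp M k + 1)) _ (1 - (x : ℂ)) :=
      hasDerivAt_zpow _ _ (Or.inl hx1)
    have e3 := (e2.comp_const_sub 1 (x : ℂ)).div_const ((cscExp M k : ℂ) + 1)
    refine (((e1.div_const ((cscExp M k : ℂ) + 1)).fun_sub e3).const_mul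
      (cscCoeff M k)).comp_ofReal.congr_deriv ?_
    push_cast
    rw [add_sub_cancel_right]
    field_simp
    ring
  have h3 := (Real.hasDerivAt_log hx.1.ne').ofReal_comp
  have h4 := ((Real.hasDerivAt_log (sub_pos.2 hx.2).ne').comp_const_sub 1 x).ofReal_comp
  have h := (h1.fun_sub (HasDerivAt.fun_sum h2)).fun_sub ((h3.fun_sub h4).const_mul (cscCoeff M M))
  refine h.congr_deriv ?_
  rw [singPart, ← Finset.add_sum_erase _ _ (Finset.mem_range.2 hn), cscExp_self, zpow_neg_one,
    zpow_neg_one, cscPow]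
  push_cast
  ring

/-- Powers of x with k < M and the logarithm are absorbed in the finite part, those with k > M
vanish, and the reflected powers tend to 1. -/
theorem tendsto_regPrimitive_zero {M n : ℕ} (hn : M < n) :
    Tendsto (regPrimitive M n) (𝓝[>] 0)
      (𝓝 (cscConst M + ∑ k ∈ (Finset.range n).erase M,
        cscCoeff M k / ((cscExp M k : ℂ) + 1))) := by
  have hset : (Finset.range n).erase M = Finset.range M ∪ Finset.Ico (M + 1) n := by
    ext k
    simp only [Finset.mem_erase, Finset.mem_range, Finset.mem_union, Finset.mem_Ico]
    omega
  have hdisj : Disjoint (Finset.range M) (Finset.Ico (M + 1) n) := by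
    rw [Finset.disjoint_left]
    intro k hk hk2
    rw [Finset.mem_range] at hk
    rw [Finset.mem_Ico] at hk2
    omega
  have hx : Tendsto (fun x : ℝ => (x : ℂ)) (𝓝[>] 0) (𝓝 0) := by
    have := (Complex.continuous_ofReal.tendsto 0).mono_left (nhdsWithin_le_nhds (s := Set.Ioi 0))
    simpa using this
  have h1 : Tendsto (fun x : ℝ => ∑ k ∈ Finset.Ico (M + 1) n,
      cscCoeff M k * ((x : ℂ) ^ (cscExp M k + 1) / ((cscExp M k : ℂ) + 1))) (𝓝[>] 0) (𝓝 0) := by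
    have : ∀ k ∈ Finset.Ico (M + 1) n, Tendsto (fun x : ℝ =>
        cscCoeff M k * ((x : ℂ) ^ (cscExp M k + 1) / ((cscExp M k : ℂ) + 1))) (𝓝[>] 0)
        (𝓝 0) := by
      intro k hk
      rw [Finset.mem_Ico] at hk
      obtain ⟨d, hd⟩ : ∃ d : ℕ, cscExp M k + 1 = ((d + 1 : ℕ) : ℤ) :=
        ⟨2 * (k - M) - 1, by rw [cscExp]; omega⟩
      rw [hd]
      simp only [zpow_natCast]
      have := ((hx.pow (d + 1)).div_const ((cscExp M k : ℂ) + 1)).const_mul (cscCoeff M k)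
      rwa [zero_pow (by omega), zero_div, mul_zero] at this
    simpa using tendsto_finsetSum _ this
  have h2 : Tendsto (fun x : ℝ => ∑ k ∈ (Finset.range n).erase M,
      cscCoeff M k * ((1 - (x : ℂ)) ^ (cscExp M k + 1) / ((cscExp M k : ℂ) + 1))) (𝓝[>] 0)
      (𝓝 (∑ k ∈ (Finset.range n).erase M, cscCoeff M k / ((cscExp M k : ℂ) + 1))) := by
    refine tendsto_finsetSum _ fun k _ => ?_
    have hc : ContinuousAt (fun z : ℂ => z ^ (cscExp M k + 1)) (1 - 0) :=
      continuousAt_zpow₀ _ _ (Or.inl (by simp))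
    have := ((hc.tendsto.comp (hx.const_sub 1)).div_const ((cscExp M k : ℂ) + 1)).const_mul
      (cscCoeff M k)
    simpa [div_eq_mul_inv, Function.comp_def] using this
  have h3 : Tendsto (fun x : ℝ => (Real.log (1 - x) : ℂ)) (𝓝[>] 0) (𝓝 0) := by
    have hc : ContinuousAt (fun x : ℝ => Real.log (1 - x)) 0 :=
      ContinuousAt.log (by fun_prop) (by norm_num)
    have := (Complex.continuous_ofReal.tendsto _).comp
      (hc.tendsto.mono_left (nhdsWithin_le_nhds (s := Set.Ioi 0)))
    simpa [Function.comp_def] using this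
  have h := (((tendsto_cscPrimitive_sub M).sub h1).add h2).add (h3.const_mul (cscCoeff M M))
  rw [sub_zero, mul_zero, add_zero] at h
  refine h.congr fun x => ?_
  simp only [regPrimitive, mul_sub, Finset.sum_sub_distrib]
  have e : ∑ k ∈ (Finset.range n).erase M,
      cscCoeff M k * ((x : ℂ) ^ (cscExp M k + 1) / ((cscExp M k : ℂ) + 1)) =
      ∑ k ∈ Finset.range M,
        cscCoeff M k * ((x : ℂ) ^ (cscExp M k + 1) / ((cscExp M k : ℂ) + 1))
      + ∑ k ∈ Finset.Ico (M + 1) n,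
        cscCoeff M k * ((x : ℂ) ^ (cscExp M k + 1) / ((cscExp M k : ℂ) + 1)) := by
    rw [hset, Finset.sum_union hdisj]
  rw [e]
  ring

/-- The antiderivative is odd about 1/2, so its limit at 1 is minus its limit at 0. -/
theorem integral_reflectGlue_regPart {M n r : ℕ} (hn : M < n) {E : ℂ → ℂ}
    (hEd : DifferentiableOn ℂ E (ball 0 1))
    (hE : ∀ z ∈ ball (0 : ℂ) 1, z ≠ 0 →
      cscPow M z = ∑ k ∈ Finset.range n, cscCoeff M k * z ^ cscExp M k + z ^ r * E z) :
    (∫ x in (0 : ℝ)..1, reflectGlue (regPart M n fun z => z ^ r * E z) x) =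
      -2 * (cscConst M + ∑ k ∈ (Finset.range n).erase M,
        cscCoeff M k / ((cscExp M k : ℂ) + 1)) := by
  have h0 := tendsto_regPrimitive_zero hn
  have hsub : Tendsto (fun x : ℝ => 1 - x) (𝓝[<] 1) (𝓝[>] 0) := by
    refine tendsto_nhdsWithin_iff.2 ⟨?_, ?_⟩
    · have : Tendsto (fun x : ℝ => 1 - x) (𝓝 1) (𝓝 (1 - 1)) :=
        (continuous_const.sub continuous_id).tendsto 1
      rw [sub_self] at this
      exact this.mono_left nhdsWithin_le_nhds
    · filter_upwards [self_mem_nhdsWithin] with x hx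
      exact Set.mem_Ioi.2 (sub_pos.2 (Set.mem_Iio.1 hx))
  have h1 : Tendsto (regPrimitive M n) (𝓝[<] 1) (𝓝 (-(cscConst M
      + ∑ k ∈ (Finset.range n).erase M, cscCoeff M k / ((cscExp M k : ℂ) + 1)))) := by
    refine (h0.comp hsub).neg.congr fun x => ?_
    rw [Function.comp_apply, regPrimitive_one_sub, neg_neg]
  have hAd : DifferentiableOn ℂ (regPart M n fun z => z ^ r * E z) (ball 0 1) :=
    differentiableOn_regPart M _ (DifferentiableOn.fun_mul (by fun_prop) hEd)
  have hcont : ContinuousOn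
      (fun x : ℝ => reflectGlue (regPart M n fun z => z ^ r * E z) x) (Set.uIcc 0 1) := by
    intro x hx
    rw [Set.uIcc_of_le zero_le_one] at hx
    have := (analyticAt_reflectGlue hAd (regPart_one_sub hE) hx).continuousAt
    exact (ContinuousAt.comp (f := fun x : ℝ => (x : ℂ)) this
      Complex.continuous_ofReal.continuousAt).continuousWithinAt
  rw [intervalIntegral.integral_eq_sub_of_hasDerivAt_of_tendsto zero_lt_one ?_
    hcont.intervalIntegrable h0 h1]
  · ring
  · intro x hx
    rw [reflectGlue_regPart_eq hE hx]
    exact hasDerivAt_regPrimitive hn hx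

theorem natCast_add_half_ne_neg (M m : ℕ) : (M : ℂ) + 1 / 2 ≠ -m := by
  intro h
  have h1 : (2 * (M + m) + 1 : ℕ) = (0 : ℂ) := by
    push_cast
    linear_combination 2 * h
  exact (2 * (M + m)).succ_ne_zero (by exact_mod_cast h1)

theorem natCast_add_one_ne_neg (M m : ℕ) : (M : ℂ) + 1 ≠ -m := by
  intro h
  have h1 : ((M + m) + 1 : ℕ) = (0 : ℂ) := by
    push_cast
    linear_combination h
  exact (M + m).succ_ne_zero (by exact_mod_cast h1)

/-- Both sides satisfy the same recursion in M. At M = 0 it reduces to ψ(1) - ψ(1/2) = 2 log 2. -/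
theorem neg_cscConst (M : ℕ) :
    -cscConst M = cscCoeff M M *
      (deriv (sincAlpha M) (2 * M + 1) / sincAlpha M (2 * M + 1)
        + 1 / 2 * Complex.digamma (M + 1) - 1 / 2 * Complex.digamma (M + 1 / 2)
        - (Real.log Real.pi : ℂ)) := by
  have hpi : (Real.pi : ℂ) ≠ 0 := by exact_mod_cast Real.pi_ne_zero
  induction M with
  | zero =>
    have hd : deriv (sincAlpha 0) (2 * ((0 : ℕ) : ℂ) + 1) = 0 := by
      rw [funext sincAlpha_zero_left, deriv_const]
    rw [hd, Nat.cast_zero, zero_add, zero_add, Complex.digamma_one, Complex.digamma_one_half,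
      cscConst, cscCoeff, sincAlpha_zero_left, Real.log_div Real.pi_ne_zero two_ne_zero]
    have : ((Real.log 2 : ℝ) : ℂ) = Complex.log 2 := by
      rw [Complex.ofReal_log (by norm_num)]
      simp
    simp only [Complex.ofReal_div, Complex.ofReal_sub, this]
    field_simp
    ring
  | succ M ih =>
    have h1 : (2 * (M : ℂ) + 1) ≠ 0 := by exact_mod_cast (2 * M).succ_ne_zero
    have h2 : (2 * (M : ℂ) + 2) ≠ 0 := by exact_mod_cast (2 * M + 1).succ_ne_zero
    have h3 := sincAlpha_self_ne_zero M
    -- The shifts ψ(z+1) = ψ(z) + 1/z contribute 1/(2M+2) - 1/(2M+1), cancelling the rational terms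
    -- of the logarithmic derivative.
    have hd1 := Complex.digamma_apply_add_one _ (natCast_add_one_ne_neg M)
    have hd2 := Complex.digamma_apply_add_one _ (natCast_add_half_ne_neg M)
    have hA : cscCoeff (M + 1) (M + 1) = (2 * M + 1) / (2 * M + 2) * cscCoeff M M := by
      have h := cscCoeff_succ_succ M M
      have he : cscExp M (M + 1) = 1 := by rw [cscExp_succ_right, cscExp_self]; norm_num
      rw [he] at h
      apply mul_left_cancel₀ (mul_ne_zero (mul_ne_zero (pow_ne_zero 2 hpi) h1) h2)
      rw [h]
      push_cast
      field_simp
      ring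
    have hB : cscCoeff M (M + 1) =
        cscCoeff M M * (sincAlpha (M + 1) (2 * M + 1) / sincAlpha M (2 * M + 1)) := by
      rw [cscCoeff, cscCoeff]
      field_simp
    rw [deriv_sincAlpha_self_succ, cscConst, hA, hB]
    have e1 : ((M + 1 : ℕ) : ℂ) + 1 = (M + 1) + 1 := by push_cast; ring
    have e2 : ((M + 1 : ℕ) : ℂ) + 1 / 2 = (M + 1 / 2) + 1 := by push_cast; ring
    have e3 : ((M : ℂ) + 1)⁻¹ = 2 / (2 * M + 2) := by
      rw [show 2 * (M : ℂ) + 2 = 2 * (M + 1) by ring]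
      rw [show 2 * (M : ℂ) + 2 = 2 * (M + 1) by ring] at h2
      have := right_ne_zero_of_mul h2
      field_simp
    have e4 : ((M : ℂ) + 1 / 2)⁻¹ = 2 / (2 * M + 1) := by
      rw [show 2 * (M : ℂ) + 1 = 2 * (M + 1 / 2) by ring]
      rw [show 2 * (M : ℂ) + 1 = 2 * (M + 1 / 2) by ring] at h1
      have := right_ne_zero_of_mul h1
      field_simp
    rw [e1, e2, hd1, hd2, e3, e4]
    have ih' : cscConst M = -(cscCoeff M M *
      (deriv (sincAlpha M) (2 * M + 1) / sincAlpha M (2 * M + 1)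
        + 1 / 2 * Complex.digamma (M + 1) - 1 / 2 * Complex.digamma (M + 1 / 2)
        - (Real.log Real.pi : ℂ))) := by rw [← ih, neg_neg]
    rw [ih']
    generalize Complex.digamma (M + 1) = a
    generalize Complex.digamma (M + 1 / 2) = b
    generalize (Real.log Real.pi : ℂ) = c
    generalize deriv (sincAlpha M) (2 * M + 1) / sincAlpha M (2 * M + 1) = d
    field_simp
    ring

theorem logCoeff_eq_cscCoeff (M : ℕ) :
    logCoeff M = 2 * cscCoeff M M / 2 ^ (2 * M + 1) := by
  rw [logCoeff_eq, cscCoeff, mul_pow]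
  field_simp

theorem constG_eq (M : ℕ) : constG M = -2 * cscConst M / 2 ^ (2 * M + 1) := by
  have h := neg_cscConst M
  rw [constG, logCoeff_eq_cscCoeff]
  linear_combination -(2 / 2 ^ (2 * M + 1)) * h

/-! ### Reduction of the energy to a cosecant sum -/

theorem norm_rootOfUnityPoint_sub {n : ℕ} (j k : Fin (n + 1)) :
    ‖rootOfUnityPoint (n + 1) j - rootOfUnityPoint (n + 1) k‖ =
      2 * Real.sin (Real.pi * (((j - k : Fin (n + 1)) : ℕ) / (n + 1 : ℕ))) := by
  set m : ℕ := ((j - k : Fin (n + 1)) : ℕ) with hm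
  have hN : ((n + 1 : ℕ) : ℂ) ≠ 0 := by exact_mod_cast n.succ_ne_zero
  have hmlt : m < n + 1 := (j - k).isLt
  -- Subtraction of indices is modulo N; t counts the full turns, invisible to the exponential.
  obtain ⟨t, ht⟩ : ∃ t : ℕ, (m : ℤ) + k = j + t * (n + 1) := by
    have h1 : ((j - k + k : Fin (n + 1)) : ℕ) = (m + k) % (n + 1) := Fin.val_add _ _
    rw [sub_add_cancel] at h1
    refine ⟨(m + k) / (n + 1), ?_⟩
    have h2 := Nat.mod_add_div (m + k) (n + 1)
    rw [← h1] at h2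
    have h3 : ((j : ℕ) + (n + 1) * ((m + k) / (n + 1)) : ℤ) = m + k := by exact_mod_cast h2
    push_cast
    linear_combination -h3
  have ht' : (m : ℂ) + (k : ℕ) = (j : ℕ) + t * (n + 1 : ℕ) := by
    push_cast
    exact_mod_cast ht
  have hexp : rootOfUnityPoint (n + 1) j =
      Complex.exp (Complex.I * ((2 * Real.pi * (m / (n + 1 : ℕ)) : ℝ) : ℂ))
        * rootOfUnityPoint (n + 1) k := by
    rw [rootOfUnityPoint, rootOfUnityPoint, ← Complex.exp_add, Complex.exp_eq_exp_iff_exists_int]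
    refine ⟨-t, ?_⟩
    push_cast at ht' hN ⊢
    field_simp
    linear_combination (-ht')
  have hk1 : ‖rootOfUnityPoint (n + 1) k‖ = 1 := by
    rw [rootOfUnityPoint, show 2 * (Real.pi : ℂ) * Complex.I * ((k : ℕ) : ℂ) / ((n + 1 : ℕ) : ℂ) =
      ((2 * Real.pi * ((k : ℕ) / (n + 1 : ℕ)) : ℝ) : ℂ) * Complex.I by push_cast; ring]
    exact Complex.norm_exp_ofReal_mul_I _
  have hfac : rootOfUnityPoint (n + 1) j - rootOfUnityPoint (n + 1) k =
      (Complex.exp (Complex.I * ((2 * Real.pi * (m / (n + 1 : ℕ)) : ℝ) : ℂ)) - 1)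
        * rootOfUnityPoint (n + 1) k := by
    rw [hexp]
    ring
  have hsin : 0 ≤ Real.sin (Real.pi * ((m : ℝ) / (n + 1 : ℕ))) := by
    have h0 : (0 : ℝ) ≤ (m : ℝ) / (n + 1 : ℕ) := by positivity
    have h1 : (m : ℝ) / (n + 1 : ℕ) ≤ 1 := by
      rw [div_le_one (by positivity)]
      exact_mod_cast hmlt.le
    exact Real.sin_nonneg_of_nonneg_of_le_pi (mul_nonneg Real.pi_pos.le h0)
      (by nlinarith [Real.pi_pos])
  rw [hfac, norm_mul, hk1, mul_one, Complex.norm_exp_I_mul_ofReal_sub_one, Real.norm_eq_abs,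
    show 2 * Real.pi * ((m : ℝ) / (n + 1 : ℕ)) / 2 = Real.pi * ((m : ℝ) / (n + 1 : ℕ)) by ring,
    abs_of_nonneg (by positivity)]

theorem rootsEnergy_eq (M : ℕ) {N : ℕ} (hN : 1 ≤ N) :
    rootsEnergy (2 * M + 1) N =
      N * (∑ k ∈ Finset.Ico 1 N, cscPow M ((k : ℂ) / N)) / 2 ^ (2 * M + 1) := by
  obtain ⟨n, rfl⟩ : ∃ n, N = n + 1 := ⟨N - 1, by omega⟩
  have hterm : ∀ j k : Fin (n + 1),
      ((‖rootOfUnityPoint (n + 1) j - rootOfUnityPoint (n + 1) k‖ : ℝ) : ℂ)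
        ^ (-(2 * (M : ℂ) + 1)) =
      cscPow M ((((j - k : Fin (n + 1)) : ℕ) : ℂ) / (n + 1 : ℕ)) / 2 ^ (2 * M + 1) := by
    intro j k
    rw [norm_rootOfUnityPoint_sub, Complex.cpow_neg,
      show 2 * (M : ℂ) + 1 = ((2 * M + 1 : ℕ) : ℂ) by push_cast; ring, Complex.cpow_natCast,
      cscPow, div_eq_mul_inv (_)⁻¹, ← mul_inv, ← mul_pow]
    push_cast
    rw [mul_comm (2 : ℂ)]
  -- The convention 0⁻¹ = 0 lets the diagonal term be included, so that the row sum can be reindexed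
  -- over the whole cyclic group.
  have hzero : cscPow M 0 = 0 := by simp [cscPow]
  have hrow : ∀ j : Fin (n + 1), ∑ k ∈ Finset.univ.erase j,
      ((‖rootOfUnityPoint (n + 1) j - rootOfUnityPoint (n + 1) k‖ : ℝ) : ℂ)
        ^ (-(2 * (M : ℂ) + 1)) =
      (∑ k ∈ Finset.Ico 1 (n + 1), cscPow M ((k : ℂ) / (n + 1 : ℕ))) / 2 ^ (2 * M + 1) := by
    intro j
    simp only [hterm]
    rw [Finset.sum_erase _ (by simp [hzero])]
    have h1 := Equiv.sum_comp (Equiv.subLeft j) (fun m : Fin (n + 1) =>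
      cscPow M (((m : ℕ) : ℂ) / (n + 1 : ℕ)) / 2 ^ (2 * M + 1))
    simp only [Equiv.subLeft_apply] at h1
    rw [h1, Fin.sum_univ_eq_sum_range
      (fun m : ℕ => cscPow M ((m : ℂ) / (n + 1 : ℕ)) / 2 ^ (2 * M + 1)),
      Finset.sum_range_eq_add_Ico _ n.succ_pos, Finset.sum_div]
    simp [hzero]
  rw [rootsEnergy, rieszEnergy, Finset.sum_congr rfl fun j _ => hrow j, Finset.sum_const,
    Finset.card_univ, Fintype.card_fin, nsmul_eq_mul]
  ring

end

/-! ### Assembling the expansion -/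

section

open Topology Metric

/-- The constant in the power sum expansion of exponent `cscExp M n`. -/
def cscSumConst (M n : ℕ) : ℂ :=
  if n = M then (Real.eulerMascheroniConstant : ℂ) else riemannZeta (2 * M + 1 - 2 * n)

/-- The antiderivative in the power sum expansion of exponent `cscExp M n`. -/
def cscSumPrimitive (M n : ℕ) (x : ℝ) : ℂ :=
  if n = M then (Real.log x : ℂ) else (x : ℂ) ^ (cscExp M n + 1) / ((cscExp M n : ℂ) + 1)

/-- The exponent 2n-(2M+1) is at most -3, equal to -1, or positive and odd, according as n < M, n =
M or n > M. -/
theorem hasPowSumExpansion_cscExp {M q n : ℕ} (hn : n < M + q + 1) :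
    HasPowSumExpansion (cscExp M n) (cscSumConst M n) (cscSumPrimitive M n) (2 * q + 1) := by
  rcases lt_trichotomy n M with h | rfl | h
  · have he : cscExp M n = -((2 * (M - n) + 1 : ℕ) : ℤ) := by
      rw [cscExp]
      omega
    have hl : cscSumConst M n = riemannZeta ((2 * (M - n) + 1 : ℕ) : ℂ) := by
      rw [cscSumConst, if_neg h.ne]
      push_cast [Nat.cast_sub h.le]
      ring_nf
    have hΨ : cscSumPrimitive M n = fun x : ℝ => (x : ℂ) ^ (-((2 * (M - n) + 1 : ℕ) : ℤ) + 1)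
        / (-((2 * (M - n) + 1 : ℕ) : ℂ) + 1) := by
      funext x
      rw [cscSumPrimitive, if_neg h.ne, he]
      push_cast
      rfl
    rw [he, hl, hΨ]
    exact hasPowSumExpansion_neg_of_two_le (by omega) _
  · have hΨ : cscSumPrimitive n n = fun x : ℝ => (Real.log x : ℂ) := by
      funext x
      rw [cscSumPrimitive, if_pos rfl]
    rw [cscExp_self, cscSumConst, if_pos rfl, hΨ]
    exact hasPowSumExpansion_neg_one _
  · obtain ⟨d, rfl⟩ : ∃ d, n = M + 1 + d := ⟨n - M - 1, by omega⟩
    have he : cscExp M (M + 1 + d) = ((2 * d + 1 : ℕ) : ℤ) := by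
      rw [cscExp]
      push_cast
      ring
    have hl : cscSumConst M (M + 1 + d) = riemannZeta (-((2 * d + 1 : ℕ) : ℂ)) := by
      rw [cscSumConst, if_neg h.ne']
      push_cast
      ring_nf
    have hΨ : cscSumPrimitive M (M + 1 + d) = fun x : ℝ =>
        (x : ℂ) ^ (((2 * d + 1 : ℕ) : ℤ) + 1) / (((2 * d + 1 : ℕ) : ℂ) + 1) := by
      funext x
      rw [cscSumPrimitive, if_neg h.ne', he]
      push_cast
      rfl
    rw [he, hl, hΨ]
    exact hasPowSumExpansion_of_odd (odd_two_mul_add_one d) (by omega)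

theorem natCast_cpow_eq (M n : ℕ) {N : ℕ} (hN : 1 ≤ N) :
    (N : ℂ) ^ (1 + (2 * M + 1) - 2 * n : ℂ) = N * (N : ℂ) ^ (-cscExp M n) := by
  have hNc : (N : ℂ) ≠ 0 := by exact_mod_cast (by omega : N ≠ 0)
  have e : (1 + (2 * M + 1) - 2 * n : ℂ) = ((1 + -cscExp M n : ℤ) : ℂ) := by
    rw [cscExp]
    push_cast
    ring
  rw [e, Complex.cpow_intCast, zpow_one_add₀ hNc]

theorem zpow_neg_mul_cscSumPrimitive {M n N : ℕ} (hN : 1 ≤ N) (hn : n ≠ M) :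
    (N : ℂ) ^ (-cscExp M n) * cscSumPrimitive M n N = N / ((cscExp M n : ℂ) + 1) := by
  have hNc : (N : ℂ) ≠ 0 := by exact_mod_cast (by omega : N ≠ 0)
  rw [cscSumPrimitive, if_neg hn, Complex.ofReal_natCast, mul_div_assoc', ← zpow_add₀ hNc]
  simp

/-- For n ≠ M the antiderivative contributes exactly N/(e+1). The last sum collects these terms,
which the regularized integral cancels. -/
theorem sum_cscCoeff_eq {M q N : ℕ} (hN : 1 ≤ N) :
    ∑ n ∈ Finset.range (M + q + 1),
        cscCoeff M n * ((N : ℂ) ^ (-cscExp M n) * (cscSumConst M n + cscSumPrimitive M n N)) =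
      cscCoeff M M * (N * (Real.eulerMascheroniConstant + Real.log N))
      + ∑ n ∈ (Finset.range (M + q + 1)).erase M,
        cscCoeff M n * (riemannZeta (2 * M + 1 - 2 * n) * (N : ℂ) ^ (-cscExp M n))
      + N * ∑ n ∈ (Finset.range (M + q + 1)).erase M, cscCoeff M n / ((cscExp M n : ℂ) + 1) := by
  rw [← Finset.add_sum_erase _ _ (Finset.mem_range.2 (by omega : M < M + q + 1)),
    add_assoc (cscCoeff M M * _), Finset.mul_sum, ← Finset.sum_add_distrib]
  congr 1
  · rw [cscExp_self, cscSumConst, cscSumPrimitive, if_pos rfl, if_pos rfl]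
    simp
  · refine Finset.sum_congr rfl fun n hn => ?_
    have hnM := Finset.ne_of_mem_erase hn
    rw [mul_add, zpow_neg_mul_cscSumPrimitive hN hnM, cscSumConst, if_neg hnM]
    ring

theorem rootsEnergy_sub_eq (M q : ℕ) {N : ℕ} (hN : 1 ≤ N) :
    rootsEnergy (2 * M + 1) N
        - (logCoeff M * (N : ℂ) ^ 2 * (Real.log N : ℂ)
          + (constG M + logCoeff M * (Real.eulerMascheroniConstant : ℂ)) * (N : ℂ) ^ 2
          + 2 / (2 * Real.pi : ℂ) ^ (2 * M + 1 : ℂ) *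
              ∑ n ∈ (Finset.range (M + q + 1)).erase M,
                sincAlpha n (2 * M + 1) * riemannZeta (2 * M + 1 - 2 * n)
                  * (N : ℂ) ^ (1 + (2 * M + 1) - 2 * n : ℂ)) =
      N / 2 ^ (2 * M + 1) *
        (∑ k ∈ Finset.Ico 1 N, cscPow M ((k : ℂ) / N)
          - N * (-2 * (cscConst M + ∑ k ∈ (Finset.range (M + q + 1)).erase M,
            cscCoeff M k / ((cscExp M k : ℂ) + 1)))
          - 2 * ∑ n ∈ Finset.range (M + q + 1),
            cscCoeff M n * ((N : ℂ) ^ (-cscExp M n)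
              * (cscSumConst M n + cscSumPrimitive M n N))) := by
  have hpi : (Real.pi : ℂ) ≠ 0 := by exact_mod_cast Real.pi_ne_zero
  have hsum : 2 / (2 * Real.pi : ℂ) ^ (2 * M + 1 : ℂ) *
              ∑ n ∈ (Finset.range (M + q + 1)).erase M,
                sincAlpha n (2 * M + 1) * riemannZeta (2 * M + 1 - 2 * n)
                  * (N : ℂ) ^ (1 + (2 * M + 1) - 2 * n : ℂ) =
      N / 2 ^ (2 * M + 1) * (2 * ∑ n ∈ (Finset.range (M + q + 1)).erase M,
        cscCoeff M n * (riemannZeta (2 * M + 1 - 2 * n) * (N : ℂ) ^ (-cscExp M n))) := by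
    rw [show (2 * M + 1 : ℂ) = ((2 * M + 1 : ℕ) : ℂ) by push_cast; ring, Complex.cpow_natCast]
    push_cast
    rw [Finset.mul_sum, Finset.mul_sum, Finset.mul_sum]
    refine Finset.sum_congr rfl fun n _ => ?_
    rw [natCast_cpow_eq M n hN, cscCoeff, mul_pow]
    field_simp
  rw [hsum, sum_cscCoeff_eq hN, rootsEnergy_eq M hN, constG_eq, logCoeff_eq_cscCoeff]
  ring

end

end

theorem theorem2 (M p : ℕ) (hp : M < p) (s : ℂ) (hs : s = 2 * M + 1) :
    (fun N : ℕ =>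
        rootsEnergy s N
          - (logCoeff M * (N : ℂ) ^ 2 * (Real.log N : ℂ)
            + (constG M + logCoeff M * (Real.eulerMascheroniConstant : ℂ)) * (N : ℂ) ^ 2
            + 2 / (2 * Real.pi : ℂ) ^ s *
                ∑ n ∈ (Finset.range (p + 1)).erase M,
                  sincAlpha n s * riemannZeta (s - 2 * n) * (N : ℂ) ^ (1 + s - 2 * n)))
      =O[atTop] (fun N : ℕ => (N : ℝ) ^ (-1 + s.re - 2 * p))
    ∧ sincAlpha M s ≠ 0
    ∧ HasDerivAt (sincAlpha M)
        (∑ m ∈ Finset.range M,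
          sincAlpha m s * (riemannZeta (2 * ((M : ℂ) - m)) / ((M : ℂ) - m))) s := by
  subst hs
  refine ⟨?_, sincAlpha_self_ne_zero M, hasDerivAt_sincAlpha M _⟩
  obtain ⟨q, rfl⟩ : ∃ q, p = M + q := ⟨p - M, by omega⟩
  obtain ⟨E, hEd, hE⟩ := exists_cscPow_expansion M q
  obtain ⟨C, hC⟩ := exists_cscPow_sum_bound hEd hE
    (l := cscSumConst M) (Ψ := cscSumPrimitive M) fun n hn => hasPowSumExpansion_cscExp hn
  rw [integral_reflectGlue_regPart (by omega) hEd hE] at hC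
  refine IsBigO.of_bound (C / 2 ^ (2 * M + 1)) ?_
  filter_upwards [eventually_ge_atTop 1] with N hN
  have hN0 : (0 : ℝ) < N := by exact_mod_cast hN
  have hrpow : (N : ℝ) ^ (-1 + (2 * (M : ℂ) + 1).re - 2 * ((M + q : ℕ) : ℝ)) =
      N * ((N : ℝ) ^ (2 * q + 1))⁻¹ := by
    -- The cosecant sum has error of order N^(-(2q+1)), and the energy carries one more factor N.
    have e : (-1 + (2 * (M : ℂ) + 1).re - 2 * ((M + q : ℕ) : ℝ)) =
        1 + -((2 * q + 1 : ℕ) : ℝ) := by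
      simp
      ring
    rw [e, Real.rpow_add hN0, Real.rpow_one, Real.rpow_neg hN0.le, Real.rpow_natCast]
  rw [rootsEnergy_sub_eq M q hN, hrpow, norm_mul, norm_div, norm_pow, Complex.norm_natCast,
    Complex.norm_ofNat, Real.norm_of_nonneg (by positivity)]
  refine (mul_le_mul_of_nonneg_left (hC N hN) (by positivity)).trans (le_of_eq ?_)
  ring
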